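/- \textbf{Theorem (higher Auslander defect formula).} Let $d\ge 1$ be an integer, $R$ a commutative artinian ring and $\Lambda$ an Artin $R$-algebra (an $R$-algebra that is finitely generated as an $R$-module). Let $\operatorname{mod}\Lambda$ be the category of finitely generated right $\Lambda$-modules, let $I$ be an injective envelope of $S_1\oplus\cdots\oplus S_n$, where $S_1,\dots,S_n$ is a complete set of representatives of the isomorphism classes of simple $R$-modules, and let $D=\operatorname{Hom}_R(-,I)$. Let $\mathcal M\subseteq\operatorname{mod}\Lambda$ be a $d$-cluster-tilting subcategory, that is, a functorially finite full subcategory with $$\mathcal M=\{X:\operatorname{Ext}^k_\Lambda(X,\mathcal M)=0,\ 1\le k\le d-1\}=\{Y:\operatorname{Ext}^k_\Lambda(\mathcal M,Y)=0,\ 1\le k\le d-1\}.$$ Let $d\text{-}\mathrm{Ex}(\mathcal M)$ be the category whose objects are the $d$-exact sequences in $\mathcal M$, i.e. complexes $\delta\colon L\to M^1\to\cdots\to M^d\to N$ in $\mathcal M$ such that for all $X,Y\in\mathcal M$ the sequences $$0\to\operatorname{Hom}(X,L)\to\operatorname{Hom}(X,M^1)\to\cdots\to\operatorname{Hom}(X,M^d)\to\operatorname{Hom}(X,N),$$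 $$0\to\operatorname{Hom}(N,Y)\to\operatorname{Hom}(M^d,Y)\to\cdots\to\operatorname{Hom}(M^1,Y)\to\operatorname{Hom}(L,Y)$$ are exact, and whose morphisms are the morphisms of complexes. The contravariant and the covariant defect of $\delta$ are $$\delta^*=\operatorname{Coker}\bigl(\operatorname{Hom}_\Lambda(-,M^d)\to\operatorname{Hom}_\Lambda(-,N)\bigr),\qquad \delta_*=\operatorname{Coker}\bigl(\operatorname{Hom}_\Lambda(M^1,-)\to\operatorname{Hom}_\Lambda(L,-)\bigr).$$ Let $\underline{\mathcal M}$ be the stable category of $\mathcal M$ (morphisms modulo those that factor through a projective module), let $\overline{\operatorname{mod}}\,\Lambda$ be the category $\operatorname{mod}\Lambda$ modulo morphisms that factor through an injective module, and let $\tau_d=D\operatorname{Tr}\Omega^{d-1}\colon\underline{\operatorname{mod}}\,\Lambda\to\overline{\operatorname{mod}}\,\Lambda$ be the $d$-Auslander--Reiten translation, with $\Omega$ the syzygy functor and $\operatorname{Tr}$ the transpose. The functor $\delta^*$ vanishes on projective modules and $\delta_*$ vanishes on injective modules. Then there is a natural isomorphism between the two bifunctors $$d\text{-}\mathrm{Ex}(\mathcal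 M)^{\mathrm{op}}\times\underline{\mathcal M}\longrightarrow\operatorname{mod}R,\qquad(\delta,X)\longmapsto D\,\delta^*(X)\quad\text{and}\quad(\delta,X)\longmapsto\delta_*(\tau_dX).$$ -/

import Mathlib

open CategoryTheory Limits Opposite
universe u v w

set_option linter.unusedSectionVars false
set_option linter.unusedVariables false

namespace HigherAR

section Stable

variable {C : Type v} [Category.{w} C] [Preadditive C]

/-- Two parallel morphisms are related if their difference factors through a projective object. -/
def projRel (C : Type v) [Category.{w} C] [Preadditive C] : HomRel C := fun X Y f g =>
  ∃ (Q : C) (_ : Projective Q) (a : X ⟶ Q) (b : Q ⟶ Y), a ≫ b = f - g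

/-- Two parallel morphisms are related if their difference factors through an injective object. -/
def injRel (C : Type v) [Category.{w} C] [Preadditive C] : HomRel C := fun X Y f g =>
  ∃ (Q : C) (_ : Injective Q) (a : X ⟶ Q) (b : Q ⟶ Y), a ≫ b = f - g

/-- The projectively stable category. -/
abbrev PStab (C : Type v) [Category.{w} C] [Preadditive C] := CategoryTheory.Quotient (projRel C)

/-- The injectively stable category. -/
abbrev IStab (C : Type v) [Category.{w} C] [Preadditive C] := CategoryTheory.Quotient (injRel C)

end Stable

section Syzygy

variable {C : Type v} [Category.{w} C] [Abelian C] [EnoughProjectives C]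

/-- The syzygy `ΩX`: the kernel of the chosen epimorphism from a projective onto `X`. -/
noncomputable abbrev syz (X : C) : C := kernel (Projective.π X)

/-- A lift of `f` to the chosen projectives. -/
noncomputable def lift₀ {X Y : C} (f : X ⟶ Y) : Projective.over X ⟶ Projective.over Y :=
  Projective.factorThru (Projective.π X ≫ f) (Projective.π Y)

@[simp]
lemma lift₀_comp {X Y : C} (f : X ⟶ Y) :
    lift₀ f ≫ Projective.π Y = Projective.π X ≫ f :=
  Projective.factorThru_comp _ _

@[simp]
lemma lift₀_comp_assoc {X Y Z : C} (f : X ⟶ Y) (h : Y ⟶ Z) :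
    lift₀ f ≫ Projective.π Y ≫ h = Projective.π X ≫ f ≫ h := by
  rw [← Category.assoc, lift₀_comp, Category.assoc]

/-- The morphism of syzygies induced by `f` and the chosen lift of `f`. -/
noncomputable def syzMap {X Y : C} (f : X ⟶ Y) : syz X ⟶ syz Y :=
  kernel.map _ _ (lift₀ f) f (lift₀_comp f).symm

@[simp]
lemma syzMap_ι {X Y : C} (f : X ⟶ Y) :
    syzMap f ≫ kernel.ι (Projective.π Y) = kernel.ι (Projective.π X) ≫ lift₀ f := by
  simp [syzMap]

@[simp]
lemma syzMap_ι_assoc {X Y Z : C} (f : X ⟶ Y) (h : Projective.over Y ⟶ Z) :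
    syzMap f ≫ kernel.ι (Projective.π Y) ≫ h = kernel.ι (Projective.π X) ≫ lift₀ f ≫ h := by
  rw [← Category.assoc, syzMap_ι, Category.assoc]

/-- If `F` lifts a morphism that factors through a projective, then the morphism which `F` induces
on syzygies factors through a projective. -/
lemma syz_key {X Y Q : C} [Projective Q] (a : X ⟶ Q) (b : Q ⟶ Y)
    (F : Projective.over X ⟶ Projective.over Y) (hF : F ≫ Projective.π Y = Projective.π X ≫ a ≫ b)
    (u : syz X ⟶ syz Y)
    (hu : u ≫ kernel.ι (Projective.π Y) = kernel.ι (Projective.π X) ≫ F) :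
    ∃ (k : Projective.over X ⟶ syz Y), kernel.ι (Projective.π X) ≫ k = u := by
  refine ⟨kernel.lift _ (F - Projective.π X ≫ a ≫ Projective.factorThru b (Projective.π Y))
    (by simp [hF]), ?_⟩
  rw [← cancel_mono (kernel.ι (Projective.π Y))]
  simp [hu]

lemma syz_rel {X Y : C} {f g : X ⟶ Y} (h : projRel C f g) (u : syz X ⟶ syz Y)
    (F : Projective.over X ⟶ Projective.over Y)
    (hF : F ≫ Projective.π Y = Projective.π X ≫ (f - g))
    (hu : u ≫ kernel.ι (Projective.π Y) = kernel.ι (Projective.π X) ≫ F) {s t : syz X ⟶ syz Y}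
    (hst : u = s - t) : projRel C s t := by
  obtain ⟨Q, _, a, b, hab⟩ := h
  obtain ⟨k, hk⟩ := syz_key a b F (by rw [hF, hab]) u hu
  exact ⟨_, inferInstance, _, k, hk.trans hst⟩

lemma projRel_refl {X Y : C} (f : X ⟶ Y) : projRel C f f :=
  ⟨Projective.over X, inferInstance, 0, 0, by simp⟩

/-- The syzygy functor on the stable category. -/
noncomputable def syzFunctor (C : Type v) [Category.{w} C] [Abelian C] [EnoughProjectives C] :
    PStab C ⥤ PStab C :=
  CategoryTheory.Quotient.lift (projRel C)
    { obj := fun X => (Quotient.functor (projRel C)).obj (syz X)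
      map := fun f => (Quotient.functor (projRel C)).map (syzMap f)
      map_id := fun X => by
        rw [← (Quotient.functor (projRel C)).map_id]
        refine CategoryTheory.Quotient.sound _ (syz_rel (projRel_refl (𝟙 X)) _
          (lift₀ (𝟙 X) - 𝟙 _) ?_ ?_ rfl) <;> simp
      map_comp := fun {X Y Z} f g => by
        rw [← (Quotient.functor (projRel C)).map_comp]
        refine CategoryTheory.Quotient.sound _ (syz_rel (projRel_refl (f ≫ g)) _
          (lift₀ (f ≫ g) - lift₀ f ≫ lift₀ g) ?_ ?_ rfl) <;> simp }
    (fun X Y f g h => CategoryTheory.Quotient.sound _ (syz_rel h _ (lift₀ f - lift₀ g)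
      (by simp) (by simp) rfl))

/-- The iterates of the syzygy functor. -/
noncomputable def syzIter (C : Type v) [Category.{w} C] [Abelian C] [EnoughProjectives C] :
    ℕ → (PStab C ⥤ PStab C)
  | 0 => 𝟭 _
  | n + 1 => syzIter C n ⋙ syzFunctor C

end Syzygy

section Transpose

variable {C : Type v} [Category.{w} C] [Abelian C] [EnoughProjectives C]
variable {C' : Type v} [Category.{w} C'] [Abelian C']

/-- The map `P₁ ⟶ P₀` of the chosen projective presentation `P₁ ⟶ P₀ ⟶ X ⟶ 0`. -/
noncomputable def presMap (X : C) : Projective.over (syz X) ⟶ Projective.over X :=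
  Projective.π (syz X) ≫ kernel.ι (Projective.π X)

@[simp]
lemma presMap_π (X : C) : presMap X ≫ Projective.π X = 0 := by simp [presMap]

/-- A lift of `f` to the first terms of the chosen presentations. -/
noncomputable def lift₁ {X Y : C} (f : X ⟶ Y) :
    Projective.over (syz X) ⟶ Projective.over (syz Y) := lift₀ (syzMap f)

@[simp]
lemma lift₁_comp {X Y : C} (f : X ⟶ Y) : lift₁ f ≫ presMap Y = presMap X ≫ lift₀ f := by
  simp only [lift₁, presMap, ← Category.assoc, lift₀_comp]
  simp

@[simp]
lemma lift₁_comp_assoc {X Y Z : C} (f : X ⟶ Y) (h : Projective.over Y ⟶ Z) :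
    lift₁ f ≫ presMap Y ≫ h = presMap X ≫ lift₀ f ≫ h := by
  rw [← Category.assoc, lift₁_comp, Category.assoc]

variable (S : Cᵒᵖ ⥤ C')

/-- The cokernel of `S P₀ ⟶ S P₁`, for the chosen presentation `P₁ ⟶ P₀ ⟶ X ⟶ 0` of `X`. -/
noncomputable abbrev trObj (X : C) : C' := cokernel (S.map (presMap X).op)

/-- The morphism induced by `f` and its chosen lift to the presentations. -/
noncomputable def trMap {X Y : C} (f : X ⟶ Y) : trObj S Y ⟶ trObj S X :=
  cokernel.map _ _ (S.map (lift₀ f).op) (S.map (lift₁ f).op) (by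
    simp only [← S.map_comp, ← op_comp, lift₁_comp])

@[simp]
lemma π_trMap {X Y : C} (f : X ⟶ Y) :
    cokernel.π (S.map (presMap Y).op) ≫ trMap S f
      = S.map (lift₁ f).op ≫ cokernel.π (S.map (presMap X).op) := by
  simp [trMap]

@[simp]
lemma π_trMap_assoc {X Y : C} {Z : C'} (f : X ⟶ Y) (h : trObj S X ⟶ Z) :
    cokernel.π (S.map (presMap Y).op) ≫ trMap S f ≫ h
      = S.map (lift₁ f).op ≫ cokernel.π (S.map (presMap X).op) ≫ h := by
  rw [← Category.assoc, π_trMap, Category.assoc]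

variable [S.Additive]

lemma tr_key {X Y Q : C} [Projective Q] (a : X ⟶ Q) (b : Q ⟶ Y)
    (F : Projective.over X ⟶ Projective.over Y) (hF : F ≫ Projective.π Y = Projective.π X ≫ a ≫ b)
    (F' : Projective.over (syz X) ⟶ Projective.over (syz Y))
    (hF' : F' ≫ presMap Y = presMap X ≫ F)
    (u : trObj S Y ⟶ trObj S X)
    (hu : cokernel.π (S.map (presMap Y).op) ≫ u
      = S.map F'.op ≫ cokernel.π (S.map (presMap X).op)) :
    ∃ k : trObj S Y ⟶ S.obj (op (Projective.over (syz X))),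
      k ≫ cokernel.π (S.map (presMap X).op) = u := by
  let β : Q ⟶ Projective.over Y := Projective.factorThru b (Projective.π Y)
  have hβ : β ≫ Projective.π Y = b := Projective.factorThru_comp _ _
  let k₀ : Projective.over X ⟶ syz Y := kernel.lift _ (F - Projective.π X ≫ a ≫ β)
    (by simp [hF, hβ])
  let k : Projective.over X ⟶ Projective.over (syz Y) :=
    Projective.factorThru k₀ (Projective.π (syz Y))
  have hk : k ≫ presMap Y = F - Projective.π X ≫ a ≫ β := by
    simp [k, presMap, k₀]
  have h0 : (F' - presMap X ≫ k) ≫ presMap Y = 0 := by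
    rw [Preadditive.sub_comp, Category.assoc, hk, hF', Preadditive.comp_sub, ← Category.assoc _ _ (a ≫ β),
      presMap_π]
    simp
  refine ⟨cokernel.desc _ (S.map (F' - presMap X ≫ k).op) ?_, ?_⟩
  · rw [← S.map_comp, ← op_comp, h0]; simp
  · rw [← cancel_epi (cokernel.π (S.map (presMap Y).op)), hu, cokernel.π_desc_assoc]
    simp [S.map_sub]

lemma tr_rel (hS : ∀ P : C, Projective P → Projective (S.obj (op P))) {X Y : C} {f g : X ⟶ Y}
    (h : projRel C f g) (F : Projective.over X ⟶ Projective.over Y)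
    (hF : F ≫ Projective.π Y = Projective.π X ≫ (f - g))
    (F' : Projective.over (syz X) ⟶ Projective.over (syz Y))
    (hF' : F' ≫ presMap Y = presMap X ≫ F)
    {s t : trObj S Y ⟶ trObj S X}
    (hu : cokernel.π (S.map (presMap Y).op) ≫ (s - t)
      = S.map F'.op ≫ cokernel.π (S.map (presMap X).op)) : projRel C' s t := by
  obtain ⟨Q, _, a, b, hab⟩ := h
  obtain ⟨k, hk⟩ := tr_key S a b F (by rw [hF, hab]) F' hF' _ hu
  exact ⟨_, hS _ inferInstance, k, _, hk⟩

/-- The transpose as a contravariant functor between stable categories, with respect to a duality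
`S` between projectives. -/
noncomputable def trFunctor (hS : ∀ P : C, Projective P → Projective (S.obj (op P))) :
    PStab C ⥤ (PStab C')ᵒᵖ :=
  CategoryTheory.Quotient.lift (projRel C)
    { obj := fun X => op ((Quotient.functor (projRel C')).obj (trObj S X))
      map := fun f => ((Quotient.functor (projRel C')).map (trMap S f)).op
      map_id := fun X => by
        rw [← op_id, ← (Quotient.functor (projRel C')).map_id]
        refine congrArg Quiver.Hom.op (CategoryTheory.Quotient.sound _ (tr_rel S hS
          (projRel_refl (𝟙 X)) (lift₀ (𝟙 X) - 𝟙 _) ?_ (lift₁ (𝟙 X) - 𝟙 _) ?_ ?_)) <;> simp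
      map_comp := fun {X Y Z} f g => by
        rw [← op_comp, ← (Quotient.functor (projRel C')).map_comp]
        refine congrArg Quiver.Hom.op (CategoryTheory.Quotient.sound _ (tr_rel S hS
          (projRel_refl (f ≫ g)) (lift₀ (f ≫ g) - lift₀ f ≫ lift₀ g) ?_
          (lift₁ (f ≫ g) - lift₁ f ≫ lift₁ g) ?_ ?_)) <;> simp }
    (fun X Y f g h => congrArg Quiver.Hom.op (CategoryTheory.Quotient.sound _ (tr_rel S hS h
      (lift₀ f - lift₀ g) (by simp) (lift₁ f - lift₁ g) (by simp) (by simp))))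

end Transpose

section FG

variable {A : Type u} [Ring A]

lemma fg_surjective_of_epi {X Y : FGModuleCat.{u} A} (f : X ⟶ Y) [Epi f] :
    Function.Surjective f.hom.hom := by
  let N := LinearMap.range f.hom.hom
  let Z : FGModuleCat.{u} A := FGModuleCat.of A (Y ⧸ N)
  have h : (FGModuleCat.ofHom N.mkQ : Y ⟶ Z) = FGModuleCat.ofHom 0 := by
    rw [← cancel_epi f]
    apply FGModuleCat.hom_ext
    ext x
    exact (Submodule.Quotient.mk_eq_zero N).2 ⟨x, rfl⟩
  have h' : N.mkQ = 0 := congrArg (fun k : Y ⟶ Z => k.hom.hom) h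
  rw [← LinearMap.range_eq_top]
  change N = ⊤
  rw [← N.ker_mkQ, h', LinearMap.ker_zero]

lemma fg_injective_of_mono {X Y : FGModuleCat.{u} A} (f : X ⟶ Y) [Mono f] :
    Function.Injective f.hom.hom := by
  rw [injective_iff_map_eq_zero]
  intro x hx
  let g : FGModuleCat.of A A ⟶ X := FGModuleCat.ofHom (LinearMap.toSpanSingleton A X x)
  have : g = 0 := by
    rw [← cancel_mono f, zero_comp]
    apply FGModuleCat.hom_ext
    ext
    change f.hom.hom ((1 : A) • x) = 0
    simp [hx]
  have h' : LinearMap.toSpanSingleton A X x = 0 := 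
    congrArg (fun k : FGModuleCat.of A A ⟶ X => k.hom.hom) this
  simpa using LinearMap.congr_fun h' 1

lemma fg_epi_of_surjective {X Y : FGModuleCat.{u} A} (f : X ⟶ Y)
    (hf : Function.Surjective f.hom.hom) : Epi f :=
  ⟨fun _ _ e => FGModuleCat.hom_ext (LinearMap.cancel_right hf |>.1
    (congrArg (fun k : X ⟶ _ => k.hom.hom) e))⟩

lemma fg_mono_of_injective {X Y : FGModuleCat.{u} A} (f : X ⟶ Y)
    (hf : Function.Injective f.hom.hom) : Mono f :=
  ⟨fun _ _ e => FGModuleCat.hom_ext (LinearMap.cancel_left hf |>.1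
    (congrArg (fun k : _ ⟶ Y => k.hom.hom) e))⟩

/-- The free module of rank `n`. -/
abbrev fgFree (A : Type u) [Ring A] (n : ℕ) : FGModuleCat.{u} A := FGModuleCat.of A (Fin n → A)

lemma fg_projective_of_module (P : FGModuleCat.{u} A) [Module.Projective A P] : Projective P where
  factors {E X} f e _ := by
    obtain ⟨g, hg⟩ := Module.projective_lifting_property e.hom.hom f.hom.hom
      (fg_surjective_of_epi e)
    exact ⟨FGModuleCat.ofHom g, FGModuleCat.hom_ext hg⟩

instance fgFree_projective (n : ℕ) : Projective (fgFree A n) :=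
  haveI : Module.Projective A (fgFree A n) := inferInstanceAs (Module.Projective A (Fin n → A))
  fg_projective_of_module _

lemma exists_fgFree_epi (X : FGModuleCat.{u} A) : ∃ (n : ℕ) (p : fgFree A n ⟶ X), Epi p := by
  obtain ⟨n, f, hf⟩ := Module.Finite.exists_fin' A X
  exact ⟨n, FGModuleCat.ofHom f, fg_epi_of_surjective _ hf⟩

instance fg_enoughProjectives : EnoughProjectives (FGModuleCat.{u} A) where
  presentation X := by
    obtain ⟨n, p, hp⟩ := exists_fgFree_epi X
    exact ⟨⟨fgFree A n, p⟩⟩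

end FG

section Dual

variable (R : Type u) [CommRing R] [IsArtinianRing R]

/-- `j : N → I` is an injective envelope: `I` is injective and `j` is an essential
monomorphism. -/
structure IsInjectiveEnvelope {R : Type u} [CommRing R] {N I : Type u} [AddCommGroup N] [Module R N] [AddCommGroup I]
    [Module R I] (j : N →ₗ[R] I) : Prop where
  injective_module : Module.Injective R I
  injective : Function.Injective j
  essential : ∀ K : Submodule R I, K ⊓ LinearMap.range j = ⊥ → K = ⊥

/-- `I` is an injective envelope of `S₁ ⊕ ⋯ ⊕ Sₙ`, where `S₁, …, Sₙ` is a complete set of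
representatives of the isomorphism classes of the simple `R`-modules. -/
class IsEnvelopeOfSimples (R : Type u) [CommRing R] (I : Type u) [AddCommGroup I] [Module R I] :
    Prop where
  exists_envelope : ∃ (n : ℕ) (S : Fin n → ModuleCat.{u} R) (j : (∀ i, S i) →ₗ[R] I),
    (∀ i, IsSimpleModule R (S i)) ∧ (∀ i k, Nonempty (S i ≃ₗ[R] S k) → i = k) ∧
    (∀ T : ModuleCat.{u} R, IsSimpleModule R T → ∃ i, Nonempty (T ≃ₗ[R] S i)) ∧
    IsInjectiveEnvelope j

variable (I : Type u) [AddCommGroup I] [Module R I] [hI : IsEnvelopeOfSimples R I]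

lemma env_injective (R : Type u) [CommRing R] (I : Type u) [AddCommGroup I] [Module R I]
    [hI : IsEnvelopeOfSimples R I] : Module.Injective R I := by
  obtain ⟨n, S, j, -, -, -, hj⟩ := hI.exists_envelope
  exact hj.injective_module

lemma finite_hom_of_finite {N T : Type u} [AddCommGroup N] [Module R N] [AddCommGroup T]
    [Module R T] [Module.Finite R N] [Module.Finite R T] : Module.Finite R (N →ₗ[R] T) := by
  obtain ⟨n, f, hf⟩ := Module.Finite.exists_fin' R N
  refine Module.Finite.of_injective (LinearMap.lcomp R T f) ?_
  intro a b h
  exact LinearMap.cancel_right hf |>.1 h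

lemma finite_hom_env {N : Type u} [AddCommGroup N] [Module R N] (hN : IsFiniteLength R N) :
    Module.Finite R (N →ₗ[R] I) := by
  obtain ⟨n, S, j, hS, -, -, hj⟩ := hI.exists_envelope
  induction hN with
  | of_subsingleton => exact Module.Finite.of_finite
  | @of_simple_quotient M _ _ N _ _ ih => 
    have h1 : Module.Finite R ((M ⧸ N) →ₗ[R] I) := by
      have hfin : ∀ i, Module.Finite R (S i) := fun i => inferInstance
      have : Module.Finite R ((M ⧸ N) →ₗ[R] (∀ i, S i)) := finite_hom_of_finite R
      refine Module.Finite.of_surjective (LinearMap.compRight R (M := M ⧸ N) j) ?_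
      intro f
      have hr : LinearMap.range f ≤ LinearMap.range j := by
        rcases LinearMap.injective_or_eq_zero f with h | h
        · have : IsSimpleModule R (LinearMap.range f) :=
            IsSimpleModule.congr (LinearEquiv.ofInjective f h).symm
          have ha : IsAtom (LinearMap.range f) := isSimpleModule_iff_isAtom.1 this
          by_contra hc
          exact ha.1 (hj.essential _ ((ha.not_le_iff_disjoint.1 hc).eq_bot))
        · simp [h]
      let e := LinearEquiv.ofInjective j hj.injective
      refine ⟨e.symm.toLinearMap ∘ₗ f.codRestrict _ (fun x => hr ⟨x, rfl⟩), ?_⟩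
      ext x
      change j (e.symm _) = _
      rw [← LinearEquiv.ofInjective_apply (h := hj.injective), LinearEquiv.apply_symm_apply]
      rfl
    have h2 : IsNoetherian R ((M ⧸ N) →ₗ[R] I) := inferInstance
    have h3 : IsNoetherian R (N →ₗ[R] I) := inferInstance
    have : IsNoetherian R (M →ₗ[R] I) := by
      refine isNoetherian_of_range_eq_ker (LinearMap.lcomp R I N.mkQ)
        (LinearMap.lcomp R I N.subtype) ?_
      ext f
      simp only [LinearMap.mem_range, LinearMap.mem_ker]
      constructor
      · rintro ⟨g, rfl⟩
        ext x
        change g (N.mkQ x) = 0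
        rw [show N.mkQ (x : M) = 0 from (Submodule.Quotient.mk_eq_zero N).2 x.2, map_zero]
      · intro h
        refine ⟨N.liftQ f fun x hx => ?_, ?_⟩
        · exact LinearMap.congr_fun h (⟨x, hx⟩ : N)
        · ext x
          rfl
    infer_instance

instance env_finite : Module.Finite R I :=
  have := finite_hom_env R I (N := R) (isFiniteLength_iff_isNoetherian_isArtinian.2
    ⟨inferInstance, inferInstance⟩)
  Module.Finite.equiv (LinearMap.ringLmapEquivSelf R R I)


lemma exists_ne_zero_of_nontrivial {N : Type u} [AddCommGroup N] [Module R N] [Module.Finite R N]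
    [Nontrivial N] : ∃ f : N →ₗ[R] I, f ≠ 0 := by
  obtain ⟨n, S, j, hS, -, hT, hj⟩ := hI.exists_envelope
  obtain ⟨m, hm, -⟩ := (eq_top_or_exists_le_coatom (⊥ : Submodule R N)).resolve_left bot_ne_top
  have : IsSimpleModule R (N ⧸ m) := isSimpleModule_iff_isCoatom.2 hm
  obtain ⟨i, ⟨e⟩⟩ := hT (ModuleCat.of R (N ⧸ m)) this
  refine ⟨j ∘ₗ LinearMap.single R (fun i => S i) i ∘ₗ e.toLinearMap ∘ₗ m.mkQ, fun h0 => ?_⟩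
  have h1 : m.mkQ = 0 := by
    ext x
    have h2 := LinearMap.congr_fun h0 x
    have h3 : e (m.mkQ x) = 0 := by
      apply Pi.single_injective (M := fun i => S i) i
      apply hj.injective
      simpa using h2
    exact e.map_eq_zero_iff.1 h3
  apply hm.1
  rw [← m.ker_mkQ, h1, LinearMap.ker_zero]

/-- The duality `D = Hom_R(-, I)` on finitely generated `R`-modules. -/
def dualR : (FGModuleCat.{u} R)ᵒᵖ ⥤ FGModuleCat.{u} R where
  obj N := 
    haveI : Module.Finite R (N.unop →ₗ[R] I) := finite_hom_env R I
      (isFiniteLength_iff_isNoetherian_isArtinian.2 ⟨inferInstance, inferInstance⟩)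
    FGModuleCat.of R (N.unop →ₗ[R] I)
  map f := ⟨ModuleCat.ofHom (LinearMap.lcomp R I f.unop.hom.hom)⟩
  map_id _ := rfl
  map_comp _ _ := rfl

variable (Λ : Type u) [Ring Λ] [Algebra R Λ] [Module.Finite R Λ]

/-- The `R`-module underlying a module over the `R`-algebra `A`. -/
@[reducible]
def fgModR (A : Type u) [Ring A] [Algebra R A] (N : FGModuleCat.{u} A) : Module R N :=
  Module.restrictScalars R A N

end Dual
section DualMod

variable (R : Type u) [CommRing R] (Λ : Type u) [Ring Λ] [Algebra R Λ]
variable (I : Type u) [AddCommGroup I] [Module R I] 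
variable (N : Type u) [AddCommGroup N] [Module R N] [Module Λ N] [IsScalarTower R Λ N]

/-- `Hom_R(N, I)` for a left `Λ`-module `N`, with its right `Λ`-module structure
`(f · a) x = f (a x)`. -/
def DualMod (R Λ I N : Type u) [CommRing R] [Ring Λ] [Algebra R Λ] [AddCommGroup I] [Module R I]
    [AddCommGroup N] [Module R N] [Module Λ N] [IsScalarTower R Λ N] : Type u := N →ₗ[R] I

instance : AddCommGroup (DualMod R Λ I N) := inferInstanceAs (AddCommGroup (N →ₗ[R] I))
instance : Module R (DualMod R Λ I N) := inferInstanceAs (Module R (N →ₗ[R] I))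

variable {R Λ I N} in
/-- The linear map underlying an element of `DualMod`. -/
def DualMod.toHom (f : DualMod R Λ I N) : N →ₗ[R] I := f

instance : Module Λᵐᵒᵖ (DualMod R Λ I N) where
  smul a f := LinearMap.comp f.toHom (Algebra.lsmul R R N a.unop)
  one_smul f := LinearMap.ext fun x => congrArg f.toHom (one_smul Λ x)
  mul_smul a b f := LinearMap.ext fun x => congrArg f.toHom (mul_smul b.unop a.unop x)
  smul_zero _ := rfl
  smul_add _ _ _ := rfl
  add_smul a b f := LinearMap.ext fun x =>
    (congrArg f.toHom (add_smul a.unop b.unop x)).trans (map_add f.toHom _ _)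
  zero_smul f := LinearMap.ext fun x =>
    (congrArg f.toHom (zero_smul Λ x)).trans (map_zero f.toHom)

instance : IsScalarTower R Λᵐᵒᵖ (DualMod R Λ I N) where
  smul_assoc r a f := LinearMap.ext fun x =>
    (congrArg f.toHom (smul_assoc r a.unop x)).trans (map_smul f.toHom r _)

lemma DualMod.smul_toHom (a : Λ) (f : DualMod R Λ I N) (x : N) :
    (MulOpposite.op a • f).toHom x = f.toHom (a • x) := rfl

lemma DualMod.finite [IsArtinianRing R] [IsEnvelopeOfSimples R I] [Module.Finite R N] :
    Module.Finite Λᵐᵒᵖ (DualMod R Λ I N) :=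
  haveI : Module.Finite R (DualMod R Λ I N) := finite_hom_env R I (N := N)
      (isFiniteLength_iff_isNoetherian_isArtinian.2 ⟨inferInstance, inferInstance⟩)
  Module.Finite.of_restrictScalars_finite R Λᵐᵒᵖ _

/-- Precomposition with a linear map, as a linear map between duals. -/
def DualMod.lcomp {N' : Type u} [AddCommGroup N'] [Module R N'] [Module Λ N']
    [IsScalarTower R Λ N'] (g : N →ₗ[Λ] N') : DualMod R Λ I N' →ₗ[Λᵐᵒᵖ] DualMod R Λ I N where
  toFun f := LinearMap.comp f.toHom (g.restrictScalars R)
  map_add' _ _ := rfl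
  map_smul' a f := LinearMap.ext fun x => congrArg f.toHom (map_smul g a.unop x).symm

/-- The dual of a free module is injective. -/
lemma DualMod.injective_free [Module.Injective R I] {n : ℕ} (e : (Fin n → Λ) ≃ₗ[Λ] N) :
    Module.Injective Λᵐᵒᵖ (DualMod R Λ I N) where
  out X Y _ _ _ _ f hf g := by
    let _ : Module R X := Module.restrictScalars R Λᵐᵒᵖ X
    let _ : Module R Y := Module.restrictScalars R Λᵐᵒᵖ Y
    have : IsScalarTower R Λᵐᵒᵖ X := IsScalarTower.restrictScalars R Λᵐᵒᵖ X
    have : IsScalarTower R Λᵐᵒᵖ Y := IsScalarTower.restrictScalars R Λᵐᵒᵖ Y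
    -- the coordinates of `g`
    let c (i : Fin n) : X →ₗ[R] I :=
      { toFun := fun x => (g x).toHom (e (Pi.single i 1))
        map_add' := fun x y => by rw [map_add]; rfl
        map_smul' := fun r x => by
          have : g (r • x) = r • g x := LinearMap.map_smul_of_tower g r x
          rw [this]; rfl }
    have hc (i : Fin n) : ∃ h : Y →ₗ[R] I, ∀ x, h (f x) = c i x :=
      Module.Injective.out (f.restrictScalars R) hf (c i)
    choose h hh using hc
    have he (r : R) (l : N) : e.symm (r • l) = r • e.symm l :=
      LinearMap.map_smul_of_tower e.symm.toLinearMap r l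
    let G (y : Y) : N →ₗ[R] I :=
      { toFun := fun l => ∑ i, h i (MulOpposite.op (e.symm l i) • y)
        map_add' := fun l m => by simp [add_smul, Finset.sum_add_distrib]
        map_smul' := fun r l => by simp [he, Finset.smul_sum] }
    refine ⟨{ toFun := fun y => (G y : DualMod R Λ I N)
              map_add' := fun y z => LinearMap.ext fun l => ?_
              map_smul' := fun a y => LinearMap.ext fun l => ?_ }, fun x => LinearMap.ext fun l => ?_⟩
    · change ∑ i, h i (MulOpposite.op (e.symm l i) • (y + z))
        = ∑ i, h i (MulOpposite.op (e.symm l i) • y) + ∑ i, h i (MulOpposite.op (e.symm l i) • z)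
      simp [Finset.sum_add_distrib]
    · change ∑ i, h i (MulOpposite.op (e.symm l i) • a • y)
        = ∑ i, h i (MulOpposite.op (e.symm (a.unop • l) i) • y)
      simp [mul_smul]
    · change ∑ i, h i (MulOpposite.op (e.symm l i) • f x) = (g x).toHom l
      have : ∀ i, h i (MulOpposite.op (e.symm l i) • f x)
          = (g x).toHom (e (Pi.single i (e.symm l i))) := by
        intro i
        rw [← map_smul, hh]
        change (g _).toHom _ = _
        rw [map_smul, DualMod.smul_toHom, ← map_smul, ← Pi.single_smul]
        simp
      simp only [this, ← map_sum]
      rw [Finset.univ_sum_single, e.apply_symm_apply]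

end DualMod

section DualFunctor

variable (R : Type u) [CommRing R] [IsArtinianRing R]
variable (Λ : Type u) [Ring Λ] [Algebra R Λ] [Module.Finite R Λ]
variable (I : Type u) [AddCommGroup I] [Module R I] [IsEnvelopeOfSimples R I]

attribute [local instance] fgModR

lemma fgTowerR (A : Type u) [Ring A] [Algebra R A] (N : FGModuleCat.{u} A) : IsScalarTower R A N :=
  IsScalarTower.restrictScalars R A N

attribute [local instance] fgTowerR

lemma fgFiniteR (A : Type u) [Ring A] [Algebra R A] [Module.Finite R A] (N : FGModuleCat.{u} A) :
    Module.Finite R N :=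
  Module.Finite.trans A N

attribute [local instance] fgFiniteR DualMod.finite

/-- The duality `D = Hom_R(-, I)` from finitely generated left `Λ`-modules to finitely generated
right `Λ`-modules. -/
def moduleDual : (FGModuleCat.{u} Λ)ᵒᵖ ⥤ FGModuleCat.{u} Λᵐᵒᵖ where
  obj N := FGModuleCat.of Λᵐᵒᵖ (DualMod R Λ I N.unop)
  map f := ⟨ModuleCat.ofHom (DualMod.lcomp R Λ I _ f.unop.hom.hom)⟩
  map_id _ := rfl
  map_comp _ _ := rfl

instance : (moduleDual R Λ I).Additive where
  map_add {X Y f g} := FGModuleCat.hom_ext (LinearMap.ext fun a => LinearMap.ext fun x =>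
    map_add (DualMod.toHom a) _ _)

variable {Λ} in
lemma injective_moduleDual_modCat {n : ℕ} (N : FGModuleCat.{u} Λ) (e : (Fin n → Λ) ≃ₗ[Λ] N) :
    Injective ((moduleDual R Λ I).obj (op N)).obj := by
  have := env_injective R I
  have h : Module.Injective Λᵐᵒᵖ (DualMod R Λ I N) := DualMod.injective_free R Λ I N e
  exact Module.injective_object_of_injective_module Λᵐᵒᵖ (DualMod R Λ I N)

variable {Λ} in
lemma injective_moduleDual {n : ℕ} (N : FGModuleCat.{u} Λ) (e : (Fin n → Λ) ≃ₗ[Λ] N) :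
    Injective ((moduleDual R Λ I).obj (op N)) where
  factors {X Y} g f _ := by
    have := env_injective R I
    have h : Module.Injective Λᵐᵒᵖ (DualMod R Λ I N) := DualMod.injective_free R Λ I N e
    obtain ⟨k, hk⟩ := h.out f.hom.hom (fg_injective_of_mono f) g.hom.hom
    exact ⟨⟨ModuleCat.ofHom k⟩, FGModuleCat.hom_ext (LinearMap.ext hk)⟩

lemma injective_moduleDual_of_projective (P : FGModuleCat.{u} Λ) (hP : Projective P) :
    Injective ((moduleDual R Λ I).obj (op P)) := by
  obtain ⟨n, p, hp⟩ := exists_fgFree_epi P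
  have := injective_moduleDual R I (fgFree Λ n) (LinearEquiv.refl Λ _)
  refine Retract.injective (Y := (moduleDual R Λ I).obj (op (fgFree Λ n)))
    ⟨(moduleDual R Λ I).map p.op, (moduleDual R Λ I).map (Projective.factorThru (𝟙 P) p).op, ?_⟩
  rw [← Functor.map_comp, ← op_comp, Projective.factorThru_comp, op_id, CategoryTheory.Functor.map_id]

/-- The functor which `D` induces from the projectively stable category of left modules to the
injectively stable category of right modules. -/
def dualStable : (PStab (FGModuleCat.{u} Λ))ᵒᵖ ⥤ IStab (FGModuleCat.{u} Λᵐᵒᵖ) :=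
  (CategoryTheory.Quotient.lift (projRel (FGModuleCat.{u} Λ))
    ((moduleDual R Λ I).rightOp ⋙ (Quotient.functor (injRel (FGModuleCat.{u} Λᵐᵒᵖ))).op)
    (fun X Y f g h => by
      obtain ⟨Q, hQ, a, b, hab⟩ := h
      refine congrArg Quiver.Hom.op (CategoryTheory.Quotient.sound _
        ⟨_, injective_moduleDual_of_projective R Λ I Q hQ, (moduleDual R Λ I).map b.op,
          (moduleDual R Λ I).map a.op, ?_⟩)
      rw [← Functor.map_comp, ← op_comp, hab, op_sub, Functor.map_sub]
      rfl)).leftOp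

end DualFunctor

section RingDual

variable (Λ : Type u) [Ring Λ]

lemma ringDual_finite [IsNoetherianRing Λ] (X : FGModuleCat.{u} Λᵐᵒᵖ) :
    Module.Finite Λ (X →ₗ[Λᵐᵒᵖ] Λ) := by
  obtain ⟨n, f, hf⟩ := Module.Finite.exists_fin' Λᵐᵒᵖ X
  have : Module.Finite Λ ((Fin n → Λᵐᵒᵖ) →ₗ[Λᵐᵒᵖ] Λ) :=
    Module.Finite.equiv (LinearEquiv.piRing Λᵐᵒᵖ Λ (Fin n) Λ).symm
  let L : (X →ₗ[Λᵐᵒᵖ] Λ) →ₗ[Λ] ((Fin n → Λᵐᵒᵖ) →ₗ[Λᵐᵒᵖ] Λ) :=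
    { toFun := fun g => g.comp f
      map_add' := fun _ _ => rfl
      map_smul' := fun _ _ => rfl }
  refine Module.Finite.of_injective L ?_
  intro a b h
  exact LinearMap.cancel_right hf |>.1 h

attribute [local instance] ringDual_finite

/-- The functor `Hom_Λ(-, Λ)` from finitely generated right `Λ`-modules to finitely generated left
`Λ`-modules. -/
def ringDual [IsNoetherianRing Λ] : (FGModuleCat.{u} Λᵐᵒᵖ)ᵒᵖ ⥤ FGModuleCat.{u} Λ where
  obj X := FGModuleCat.of Λ (X.unop →ₗ[Λᵐᵒᵖ] Λ)
  map f := ⟨ModuleCat.ofHom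
    { toFun := fun g => g.comp f.unop.hom.hom
      map_add' := fun _ _ => rfl
      map_smul' := fun _ _ => rfl }⟩
  map_id _ := rfl
  map_comp _ _ := rfl

variable [IsNoetherianRing Λ]

instance : (ringDual Λ).Additive where
  map_add := FGModuleCat.hom_ext (LinearMap.ext fun a => LinearMap.ext fun _ =>
    map_add (show _ →ₗ[Λᵐᵒᵖ] Λ from a) _ _)

lemma projective_ringDual_fgFree (n : ℕ) : Projective ((ringDual Λ).obj (op (fgFree Λᵐᵒᵖ n))) :=
  haveI : Module.Projective Λ ((ringDual Λ).obj (op (fgFree Λᵐᵒᵖ n))) :=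
    Module.Projective.of_equiv (LinearEquiv.piRing Λᵐᵒᵖ Λ (Fin n) Λ).symm
  fg_projective_of_module _

lemma projective_ringDual (P : FGModuleCat.{u} Λᵐᵒᵖ) (hP : Projective P) :
    Projective ((ringDual Λ).obj (op P)) := by
  obtain ⟨n, p, hp⟩ := exists_fgFree_epi P
  have := projective_ringDual_fgFree Λ n
  refine Retract.projective (Y := (ringDual Λ).obj (op (fgFree Λᵐᵒᵖ n)))
    ⟨(ringDual Λ).map p.op, (ringDual Λ).map (Projective.factorThru (𝟙 P) p).op, ?_⟩
  rw [← Functor.map_comp, ← op_comp, Projective.factorThru_comp, op_id, CategoryTheory.Functor.map_id]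

end RingDual

section ClusterTilting

/-- Contravariantly finite subcategories: every object has a right approximation. -/
def IsContravariantlyFinite {C : Type v} [Category.{w} C] (M : ObjectProperty C) : Prop :=
  ∀ Y : C, ∃ (X : C) (_ : M X) (f : X ⟶ Y),
    ∀ X' : C, M X' → ∀ g : X' ⟶ Y, ∃ h : X' ⟶ X, h ≫ f = g

/-- Covariantly finite subcategories: every object has a left approximation. -/
def IsCovariantlyFinite {C : Type v} [Category.{w} C] (M : ObjectProperty C) : Prop :=
  ∀ Y : C, ∃ (X : C) (_ : M X) (f : Y ⟶ X),
    ∀ X' : C, M X' → ∀ g : Y ⟶ X', ∃ h : X ⟶ X', f ≫ h = g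

/-- `d`-cluster-tilting subcategories of the category of finitely generated modules. The two
equalities force such a subcategory to be closed under direct sums and direct summands. -/
structure IsClusterTilting {A : Type u} [Ring A] (d : ℕ) (M : ObjectProperty (FGModuleCat.{u} A)) :
    Prop where
  contravariantlyFinite : IsContravariantlyFinite M
  covariantlyFinite : IsCovariantlyFinite M
  mem_iff_left : ∀ X : FGModuleCat.{u} A, M X ↔ ∀ k : ℕ, 1 ≤ k → k < d →
    ∀ Y : FGModuleCat.{u} A, M Y → Subsingleton (Abelian.Ext.{u} X.obj Y.obj k)
  mem_iff_right : ∀ Y : FGModuleCat.{u} A, M Y ↔ ∀ k : ℕ, 1 ≤ k → k < d →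
    ∀ X : FGModuleCat.{u} A, M X → Subsingleton (Abelian.Ext.{u} X.obj Y.obj k)

lemma IsClusterTilting.mem_of_projective {A : Type u} [Ring A] {d : ℕ}
    {M : ObjectProperty (FGModuleCat.{u} A)} (hM : IsClusterTilting d M) (P : FGModuleCat.{u} A)
    (hP : Projective P.obj) : M P := by
  refine (hM.mem_iff_left P).2 fun k hk _ Y _ => ?_
  obtain ⟨k, rfl⟩ : ∃ n, k = n + 1 := ⟨k - 1, by omega⟩
  exact subsingleton_of_forall_eq 0 fun e => e.eq_zero_of_projective

lemma IsClusterTilting.mem_of_injective {A : Type u} [Ring A] {d : ℕ}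
    {M : ObjectProperty (FGModuleCat.{u} A)} (hM : IsClusterTilting d M) (E : FGModuleCat.{u} A)
    (hE : Injective E.obj) : M E := by
  refine (hM.mem_iff_right E).2 fun k hk _ Y _ => ?_
  obtain ⟨k, rfl⟩ : ∃ n, k = n + 1 := ⟨k - 1, by omega⟩
  exact subsingleton_of_forall_eq 0 fun e => e.eq_zero_of_injective

lemma IsClusterTilting.fgFree_mem {A : Type u} [Ring A] {d : ℕ}
    {M : ObjectProperty (FGModuleCat.{u} A)} (hM : IsClusterTilting d M) (n : ℕ) :
    M (fgFree A n) :=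
  hM.mem_of_projective _ (ModuleCat.projective_of_free (Pi.basisFun A (Fin n)))

end ClusterTilting

section DExact

variable {C : Type v} [Category.{w} C] [Preadditive C] {d : ℕ}

/-- A sequence `L ⟶ M¹ ⟶ ⋯ ⟶ Mᵈ ⟶ N` (with terms indexed by `0, …, d + 1`) is left `d`-exact: it
is a complex and `0 ⟶ (X, L) ⟶ (X, M¹) ⟶ ⋯ ⟶ (X, Mᵈ) ⟶ (X, N)` is exact for all `X`. -/
structure IsLeftDExact (F : ComposableArrows C (d + 1)) : Prop where
  isComplex : F.IsComplex
  mono : ∀ (X : C) (f : X ⟶ F.obj' 0), f ≫ F.map' 0 1 = 0 → f = 0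
  exact : ∀ (i : ℕ) (hi : i + 2 ≤ d + 1) (X : C) (f : X ⟶ F.obj' (i + 1)),
    f ≫ F.map' (i + 1) (i + 2) = 0 → ∃ g : X ⟶ F.obj' i, g ≫ F.map' i (i + 1) = f

/-- A sequence `L ⟶ M¹ ⟶ ⋯ ⟶ Mᵈ ⟶ N` (with terms indexed by `0, …, d + 1`) is right `d`-exact: it
is a complex and `0 ⟶ (N, Y) ⟶ (Mᵈ, Y) ⟶ ⋯ ⟶ (M¹, Y) ⟶ (L, Y)` is exact for all `Y`. -/
structure IsRightDExact (F : ComposableArrows C (d + 1)) : Prop where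
  isComplex : F.IsComplex
  epi : ∀ (Y : C) (f : F.obj' (d + 1) ⟶ Y), F.map' d (d + 1) ≫ f = 0 → f = 0
  exact : ∀ (i : ℕ) (hi : i + 2 ≤ d + 1) (Y : C) (f : F.obj' (i + 1) ⟶ Y),
    F.map' i (i + 1) ≫ f = 0 → ∃ g : F.obj' (i + 2) ⟶ Y, F.map' (i + 1) (i + 2) ≫ g = f

/-- `d`-exact sequences. -/
def isDExact (d : ℕ) (C : Type v) [Category.{w} C] [Preadditive C] :
    ObjectProperty (ComposableArrows C (d + 1)) :=
  fun F => IsLeftDExact F ∧ IsRightDExact F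

/-- The category of `d`-exact sequences; morphisms are morphisms of complexes. -/
abbrev DEx (d : ℕ) (C : Type v) [Category.{w} C] [Preadditive C] :=
  (isDExact d C).FullSubcategory

end DExact

section Coker

variable {R : Type u} [CommRing R] {A B A' B' A'' B'' : Type u}
  [AddCommGroup A] [Module R A] [AddCommGroup B] [Module R B] [Module.Finite R B]
  [AddCommGroup A'] [Module R A'] [AddCommGroup B'] [Module R B'] [Module.Finite R B']

/-- The cokernel of a linear map with finitely generated target. -/
def fgCoker (f : A →ₗ[R] B) : FGModuleCat.{u} R := FGModuleCat.of R (B ⧸ LinearMap.range f)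

/-- The class of an element in the cokernel. -/
def fgCokerMk (f : A →ₗ[R] B) : B →ₗ[R] fgCoker f := (LinearMap.range f).mkQ

lemma fgCokerMk_surjective (f : A →ₗ[R] B) : Function.Surjective (fgCokerMk f) :=
  (LinearMap.range f).mkQ_surjective

lemma fgCokerMk_eq (f : A →ₗ[R] B) {x y : B} (h : ∃ a, f a = x - y) :
    fgCokerMk f x = fgCokerMk f y :=
  (Submodule.Quotient.eq _).2 h

/-- The map on cokernels induced by a map on targets that respects the images. -/
def fgCokerMap {f : A →ₗ[R] B} {f' : A' →ₗ[R] B'} (b : B →ₗ[R] B')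
    (h : ∀ a, ∃ a', f' a' = b (f a)) : fgCoker f ⟶ fgCoker f' :=
  ⟨ModuleCat.ofHom (Submodule.mapQ _ _ b (by rintro _ ⟨a, rfl⟩; exact h a))⟩

@[simp]
lemma fgCokerMap_mk {f : A →ₗ[R] B} {f' : A' →ₗ[R] B'} (b : B →ₗ[R] B')
    (h : ∀ a, ∃ a', f' a' = b (f a)) (x : B) :
    (fgCokerMap b h).hom.hom (fgCokerMk f x) = fgCokerMk f' (b x) := rfl

lemma fgCoker_hom_ext {f : A →ₗ[R] B} {Z : FGModuleCat.{u} R} {g h : fgCoker f ⟶ Z}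
    (H : ∀ x, g.hom.hom (fgCokerMk f x) = h.hom.hom (fgCokerMk f x)) : g = h :=
  FGModuleCat.hom_ext (LinearMap.ext fun x => by
    obtain ⟨x, rfl⟩ := fgCokerMk_surjective f x
    exact H x)

end Coker

section Defect

variable (R : Type u) [CommRing R] [IsArtinianRing R]
variable {Λ : Type u} [Ring Λ] [Algebra R Λ] [Module.Finite R Λ]

attribute [local instance] fgModR fgTowerR fgFiniteR

instance linearModuleCat (R : Type u) [CommRing R] (Λ : Type u) [Ring Λ] [Algebra R Λ] :
    Linear R (ModuleCat.{u} Λᵐᵒᵖ) :=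
  letI (M : ModuleCat.{u} Λᵐᵒᵖ) : Module R M := Module.restrictScalars R Λᵐᵒᵖ M
  haveI (M : ModuleCat.{u} Λᵐᵒᵖ) : IsScalarTower R Λᵐᵒᵖ M := IsScalarTower.restrictScalars R Λᵐᵒᵖ M
  { homModule := fun _ _ => inferInstance
    smul_comp := fun _ _ _ r f g => ModuleCat.hom_ext (LinearMap.ext fun x =>
      LinearMap.map_smul_of_tower g.hom r (f.hom x))
    comp_smul := fun _ _ _ _ _ _ => rfl }

lemma finite_hom (X Y : FGModuleCat.{u} Λᵐᵒᵖ) : Module.Finite R (X ⟶ Y) := by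
  have : Module.Finite R (X →ₗ[R] Y) := finite_hom_of_finite R
  let L : (X ⟶ Y) →ₗ[R] (X →ₗ[R] Y) :=
    { toFun := fun f => f.hom.hom.restrictScalars R
      map_add' := fun _ _ => rfl
      map_smul' := fun _ _ => rfl }
  refine Module.Finite.of_injective L fun f g h => ?_
  apply FGModuleCat.hom_ext
  ext x
  exact LinearMap.congr_fun h x

variable {d : ℕ} {M : ObjectProperty (FGModuleCat.{u} Λᵐᵒᵖ)}

lemma finite_hom_sub (X Y : M.FullSubcategory) : Module.Finite R (X ⟶ Y) :=
  have : Module.Finite R (M.ι.obj X ⟶ M.ι.obj Y) := finite_hom R X.obj Y.obj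
  Module.Finite.of_injective (M.ι.mapLinearMap R (X := X) (Y := Y)) M.ι.map_injective

attribute [local instance] finite_hom finite_hom_sub

/-- The contravariant defect `δ^*(X) = Coker (Hom(X, Mᵈ) ⟶ Hom(X, N))`. -/
def contraDefectObj (δ : DEx d M.FullSubcategory) (X : M.FullSubcategory) : FGModuleCat.{u} R :=
  fgCoker (Linear.rightComp R X (δ.obj.map' d (d + 1)))

/-- The covariant defect `δ_*(Y) = Coker (Hom(M¹, Y) ⟶ Hom(L, Y))`. -/
def covDefectObj (δ : DEx d M.FullSubcategory) (Y : FGModuleCat.{u} Λᵐᵒᵖ) : FGModuleCat.{u} R :=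
  fgCoker (Linear.leftComp R Y (δ.obj.map' 0 1).hom)

/-- The contravariant defect as a bifunctor. -/
def contraDefect (d : ℕ) (M : ObjectProperty (FGModuleCat.{u} Λᵐᵒᵖ)) :
    M.FullSubcategoryᵒᵖ ⥤ DEx d M.FullSubcategory ⥤ FGModuleCat.{u} R where
  obj X :=
    { obj := fun δ => contraDefectObj R δ X.unop
      map := fun φ => fgCokerMap
        (Linear.rightComp R X.unop (ComposableArrows.app' φ.hom (d + 1)))
        (fun g => ⟨g ≫ ComposableArrows.app' φ.hom d, by
          simp [ComposableArrows.naturality' φ.hom d (d + 1)]⟩)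
      map_id := fun _ => fgCoker_hom_ext fun g => congrArg (fgCokerMk _) (Category.comp_id g)
      map_comp := fun _ _ => fgCoker_hom_ext fun g =>
        congrArg (fgCokerMk _) (Category.assoc g _ _).symm }
  map {X Y} f :=
    { app := fun δ => fgCokerMap (Linear.leftComp R (δ.obj.obj' (d + 1)) f.unop)
        (fun g => ⟨f.unop ≫ g, by simp⟩)
      naturality := fun {_ _} φ => fgCoker_hom_ext fun g => congrArg (fgCokerMk _)
        (Category.assoc f.unop g (ComposableArrows.app' φ.hom (d + 1))).symm }
  map_id X := NatTrans.ext (funext fun _ => fgCoker_hom_ext fun g =>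
    congrArg (fgCokerMk _) (Category.id_comp g))
  map_comp f g := NatTrans.ext (funext fun _ => fgCoker_hom_ext fun h =>
    congrArg (fgCokerMk _) (Category.assoc g.unop f.unop h))

/-- The covariant defect as a bifunctor. -/
def covDefect (d : ℕ) (M : ObjectProperty (FGModuleCat.{u} Λᵐᵒᵖ)) :
    FGModuleCat.{u} Λᵐᵒᵖ ⥤ (DEx d M.FullSubcategory)ᵒᵖ ⥤ FGModuleCat.{u} R where
  obj Y :=
    { obj := fun δ => covDefectObj R δ.unop Y
      map := fun {δ ε} φ => fgCokerMap
        (Linear.leftComp R Y (ComposableArrows.app' φ.unop.hom 0).hom)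
        (fun g => ⟨(ComposableArrows.app' φ.unop.hom 1).hom ≫ g, by
          have := congrArg (fun k => k.hom) (ComposableArrows.naturality' φ.unop.hom 0 1)
          change (ε.unop.obj.map' 0 1).hom ≫ (ComposableArrows.app' φ.unop.hom 1).hom =
            (ComposableArrows.app' φ.unop.hom 0).hom ≫ (δ.unop.obj.map' 0 1).hom at this
          simp only [Linear.leftComp_apply]
          rw [← Category.assoc, this, Category.assoc]⟩)
      map_id := fun _ => fgCoker_hom_ext fun g => congrArg (fgCokerMk _) (Category.id_comp g)
      map_comp := fun _ _ => fgCoker_hom_ext fun g =>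
        congrArg (fgCokerMk _) (Category.assoc _ _ g) }
  map {X Y} f :=
    { app := fun δ => fgCokerMap (Linear.rightComp R (δ.unop.obj.obj' 0).obj f)
        (fun g => ⟨g ≫ f, (Category.assoc _ g f).symm⟩)
      naturality := fun {_ _} φ => fgCoker_hom_ext fun g => congrArg (fgCokerMk _)
        (Category.assoc (ComposableArrows.app' φ.unop.hom 0).hom g f) }
  map_id X := NatTrans.ext (funext fun _ => fgCoker_hom_ext fun g =>
    congrArg (fgCokerMk _) (Category.comp_id g))
  map_comp f g := NatTrans.ext (funext fun _ => fgCoker_hom_ext fun h =>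
    congrArg (fgCokerMk _) (Category.assoc h f g).symm)

/-- The morphisms of a subcategory `M` whose difference factors through a projective module. -/
def subProjRel (M : ObjectProperty (FGModuleCat.{u} Λᵐᵒᵖ)) : HomRel M.FullSubcategory :=
  fun _ _ f g => projRel (FGModuleCat.{u} Λᵐᵒᵖ) f.hom g.hom

/-- The stable category of a subcategory `M`. -/
abbrev SubStab (M : ObjectProperty (FGModuleCat.{u} Λᵐᵒᵖ)) := CategoryTheory.Quotient (subProjRel M)

/-- The inclusion of the stable category of `M` into the stable category of all modules. -/
def SubStab.incl (M : ObjectProperty (FGModuleCat.{u} Λᵐᵒᵖ)) :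
    SubStab M ⥤ PStab (FGModuleCat.{u} Λᵐᵒᵖ) :=
  CategoryTheory.Quotient.lift (subProjRel M) (M.ι ⋙ Quotient.functor _)
    (fun _ _ _ _ h => CategoryTheory.Quotient.sound _ h)

lemma DEx.mono (hM : IsClusterTilting d M) (δ : DEx d M.FullSubcategory) :
    Mono (δ.obj.map' 0 1).hom := by
  refine Preadditive.mono_of_cancel_zero _ fun {Z} u hu => ?_
  obtain ⟨n, p, hp⟩ := exists_fgFree_epi Z
  rw [← cancel_epi p, comp_zero]
  let F : M.FullSubcategory := ⟨fgFree Λᵐᵒᵖ n, hM.fgFree_mem n⟩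
  let q : F ⟶ δ.obj.obj' 0 := ObjectProperty.homMk (p ≫ u)
  have hq : q = 0 := δ.property.1.mono F q (by
    apply ObjectProperty.hom_ext
    change (p ≫ u) ≫ _ = 0
    rw [Category.assoc, hu, comp_zero])
  exact congrArg (fun k => k.hom) hq


lemma DEx.epi (R : Type u) [CommRing R] [IsArtinianRing R] {Λ : Type u} [Ring Λ] [Algebra R Λ]
    [Module.Finite R Λ] {d : ℕ} {M : ObjectProperty (FGModuleCat.{u} Λᵐᵒᵖ)}
    (I : Type u) [AddCommGroup I] [Module R I] [IsEnvelopeOfSimples R I]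
    (hM : IsClusterTilting d M) (δ : DEx d M.FullSubcategory) :
    Epi (δ.obj.map' d (d + 1)).hom := by
  let N := (δ.obj.obj' (d + 1)).obj
  let p : (δ.obj.obj' d).obj ⟶ N := (δ.obj.map' d (d + 1)).hom
  refine fg_epi_of_surjective p ?_
  rw [← LinearMap.range_eq_top]
  by_contra hne
  let K := LinearMap.range p.hom.hom
  have : Nontrivial (N ⧸ K) := Submodule.Quotient.nontrivial_iff.2 hne
  let _ : Module R (N ⧸ K) := Module.restrictScalars R Λᵐᵒᵖ _
  have : IsScalarTower R Λᵐᵒᵖ (N ⧸ K) := IsScalarTower.restrictScalars R Λᵐᵒᵖ _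
  have : Module.Finite R (N ⧸ K) := Module.Finite.trans Λᵐᵒᵖ _
  obtain ⟨f, hf⟩ := exists_ne_zero_of_nontrivial R I (N := N ⧸ K)
  obtain ⟨F, ⟨b⟩⟩ : ∃ F : FGModuleCat.{u} Λ, Nonempty ((Fin 1 → Λ) ≃ₗ[Λ] F) :=
    ⟨fgFree Λ 1, ⟨LinearEquiv.refl Λ _⟩⟩
  let c : F →ₗ[Λ] Λ := LinearMap.proj 0 ∘ₗ b.symm.toLinearMap
  have hc : c (b fun _ => 1) = 1 := by simp [c]
  let E : M.FullSubcategory :=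
    ⟨(moduleDual R Λ I).obj (op F), hM.mem_of_injective _ (injective_moduleDual_modCat R I F b)⟩
  -- the morphism `N ⟶ D Λ` corresponding to `f`
  let e (x : N) : F →ₗ[R] I :=
    { toFun := fun l => f (MulOpposite.op (c l) • K.mkQ x)
      map_add' := fun l m => by
        rw [← map_add, ← add_smul, map_add]; rfl
      map_smul' := fun r l => by
        have : c (r • l) = r • c l := LinearMap.map_smul_of_tower c r l
        rw [this, MulOpposite.op_smul, smul_assoc, map_smul]; rfl }
  let g : N →ₗ[Λᵐᵒᵖ] DualMod R Λ I F :=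
    { toFun := fun x => e x
      map_add' := fun x y => LinearMap.ext fun l => by
        change f _ = f _ + f _
        rw [← map_add, ← smul_add, ← map_add]
      map_smul' := fun a x => LinearMap.ext fun l => by
        change f (MulOpposite.op (c l) • K.mkQ (a • x))
          = f (MulOpposite.op (c (a.unop • l)) • K.mkQ x)
        rw [map_smul c, K.mkQ.map_smul, smul_eq_mul, MulOpposite.op_mul, mul_smul,
          MulOpposite.op_unop] }
  let g' : δ.obj.obj' (d + 1) ⟶ E := ObjectProperty.homMk ⟨ModuleCat.ofHom g⟩
  have hg : g' = 0 := δ.property.2.epi E g' (by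
    apply ObjectProperty.hom_ext
    apply FGModuleCat.hom_ext
    refine LinearMap.ext fun x => LinearMap.ext fun l => ?_
    change f (MulOpposite.op (c l) • K.mkQ (p.hom.hom x)) = 0
    have : K.mkQ (p.hom.hom x) = 0 := (Submodule.Quotient.mk_eq_zero K).2 ⟨x, rfl⟩
    rw [this, smul_zero, map_zero])
  have hg0 (x : N) : e x = 0 := congrArg (fun k : δ.obj.obj' (d + 1) ⟶ E => k.hom.hom.hom x) hg
  refine hf (LinearMap.ext fun x => ?_)
  obtain ⟨x, rfl⟩ := K.mkQ_surjective x
  have h1 : f (MulOpposite.op (c (b fun _ => 1)) • K.mkQ x) = 0 :=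
    LinearMap.congr_fun (hg0 x) (b fun _ => 1)
  rw [hc, MulOpposite.op_one, one_smul] at h1
  exact h1

section

variable (I : Type u) [AddCommGroup I] [Module R I] [IsEnvelopeOfSimples R I]

/-- The contravariant defect on the stable category of `M`. -/
def contraDefectStable (hM : IsClusterTilting d M) :
    SubStab M ⥤ (DEx d M.FullSubcategory ⥤ FGModuleCat.{u} R)ᵒᵖ :=
  CategoryTheory.Quotient.lift (subProjRel M) (contraDefect R d M).rightOp
    (fun X Y f g h => congrArg Quiver.Hom.op (by
      obtain ⟨Q, hQ, a, b, hab⟩ := h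
      refine NatTrans.ext (funext fun δ => ?_)
      refine fgCoker_hom_ext (f := Linear.rightComp R Y (δ.obj.map' d (d + 1)))
        fun k => fgCokerMk_eq _ ?_
      let p := (δ.obj.map' d (d + 1)).hom
      have : Epi p := DEx.epi R I hM δ
      refine ⟨ObjectProperty.homMk (a ≫ Projective.factorThru (b ≫ k.hom) p),
        ObjectProperty.hom_ext _ ?_⟩
      change (a ≫ Projective.factorThru (b ≫ k.hom) p) ≫ p = f.hom ≫ k.hom - g.hom ≫ k.hom
      rw [Category.assoc, Projective.factorThru_comp, ← Category.assoc, hab,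
        Preadditive.sub_comp]))

/-- The covariant defect on the injectively stable category. -/
def covDefectStable (hM : IsClusterTilting d M) :
    IStab (FGModuleCat.{u} Λᵐᵒᵖ) ⥤ (DEx d M.FullSubcategory)ᵒᵖ ⥤ FGModuleCat.{u} R :=
  CategoryTheory.Quotient.lift (injRel (FGModuleCat.{u} Λᵐᵒᵖ)) (covDefect R d M)
    (fun X Y f g h => by
      obtain ⟨Q, hQ, a, b, hab⟩ := h
      refine NatTrans.ext (funext fun δ => ?_)
      refine fgCoker_hom_ext (f := Linear.leftComp R X (δ.unop.obj.map' 0 1).hom)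
        fun k => fgCokerMk_eq _ ?_
      let p := (δ.unop.obj.map' 0 1).hom
      have : Mono p := DEx.mono hM δ.unop
      refine ⟨Injective.factorThru (k ≫ a) p ≫ b, ?_⟩
      change p ≫ Injective.factorThru (k ≫ a) p ≫ b = k ≫ f - k ≫ g
      rw [← Category.assoc, Injective.comp_factorThru, Category.assoc, hab,
        Preadditive.comp_sub])

variable (Λ) in
/-- The functor `τ_d = D Tr Ω^(d-1)` from the projectively to the injectively stable category of
finitely generated right `Λ`-modules. -/
noncomputable def tau (d : ℕ) : PStab (FGModuleCat.{u} Λᵐᵒᵖ) ⥤ IStab (FGModuleCat.{u} Λᵐᵒᵖ) :=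
  haveI : IsNoetherianRing Λ := IsNoetherianRing.of_finite R Λ
  haveI : IsNoetherianRing Λᵐᵒᵖ := IsNoetherianRing.of_finite R Λᵐᵒᵖ
  syzIter (FGModuleCat.{u} Λᵐᵒᵖ) (d - 1) ⋙
    trFunctor (ringDual Λ) (projective_ringDual Λ) ⋙ dualStable R Λ I

/-- The bifunctor `(δ, X) ↦ D δ^*(X)`. -/
def dualContraDefect (hM : IsClusterTilting d M) :
    (DEx d M.FullSubcategory)ᵒᵖ × SubStab M ⥤ FGModuleCat.{u} R :=
  Functor.uncurry.obj (contraDefectStable R I hM ⋙ Functor.opHom _ _ ⋙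
    (Functor.whiskeringRight _ _ _).obj (dualR R I)).flip

/-- The bifunctor `(δ, X) ↦ δ_*(τ_d X)`. -/
noncomputable def covDefectTau (hM : IsClusterTilting d M) :
    (DEx d M.FullSubcategory)ᵒᵖ × SubStab M ⥤ FGModuleCat.{u} R :=
  Functor.uncurry.obj (SubStab.incl M ⋙ tau R Λ I d ⋙ covDefectStable R hM).flip

end

end Defect

end HigherAR

/-! Write `d = e + 1` and let `K` be the sequence `L = K₀ ⟶ ⋯ ⟶ K_{e+2} = N` of modules underlying
`δ`. It is exact as a sequence of modules: left `d`-exactness is tested on free modules, and right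
`d`-exactness on `DΛ` shows that the last map is onto. Let `Z = Ωᵉ X`, with presentation `P₁ ⟶ P₀ ⟶
Z`; these are the terms of degrees `d` and `d - 1` in a projective resolution of `X`.

Two identifications give the formula. On the one hand, `f : X ⟶ N` lifts to a chain map from the
resolution to `K`, whose last component is some `g : P₁ ⟶ L`. Since `Extᵏ(X, Kᵢ) = 0` for `1 ≤ k ≤ d
- 1`, the correspondence between `f` and `g` identifies `δ^*(X)` with the kernel of `Hom(P₁,
L)/Hom(P₀, L) ⟶ Hom(P₁, M¹)/Hom(P₀, M¹)`, where `Hom(P₀, -)` stands for its image. On the other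
hand, `Hom(P₁, L) ≅ L ⊗ Hom(P₁, Λ)`, so `Hom(P₁, L)/Hom(P₀, L) ≅ L ⊗ Tr Z` and its dual is `Hom(L, D
Tr Z)`. As `D` is exact, dualizing the kernel gives the cokernel of `Hom(M¹, D Tr Z) ⟶ Hom(L, D Tr
Z)`, which is `δ_*(τ_d X)`.

Lifts are not unique, so the correspondence is kept as a relation, `ResRel`, and neither tensor
products nor homology of complexes are formed. The pairing `trPair` identifies morphisms `L ⟶ D Tr
Z` with functionals on `Hom(P₁, L)` that kill the maps factoring through `P₁ ⟶ P₀`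
(`exists_trPair_eq`, `eq_zero_of_trPair_eq_zero`). Transported along `ResRel` it becomes `resPair`,
with values in the functionals on `Hom(X, N)`. Its kernel (`exists_comp_eq_of_resPair`) and image
(`exists_resPair_eq`) yield the isomorphism, and `resPair_naturality` its naturality. -/

namespace HigherAR

/-! ### Dimension shifting along an exact sequence, one syzygy at a time. -/

section SyzygyRelation

variable {C : Type v} [Category.{w} C] [Abelian C] [EnoughProjectives C] {m : ℕ}

/-- `f : Z ⟶ Kᵢ` is a cocycle; there is no condition if `Kᵢ` is the last term. -/
def IsCocycle (K : ComposableArrows C m) {Z : C} (i : ℕ) (hi : i ≤ m) (f : Z ⟶ K.obj' i) : Prop :=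
  ∀ h : i + 1 ≤ m, f ≫ K.map' i (i + 1) = 0

/-- A sequence `0 ⟶ K₀ ⟶ ⋯ ⟶ Kₘ ⟶ 0` which is exact, tested on projective objects. -/
structure IsExactSeq (K : ComposableArrows C m) : Prop where
  zero : ∀ (i : ℕ) (hi : i + 2 ≤ m), K.map' i (i + 1) ≫ K.map' (i + 1) (i + 2) = 0
  mono : ∀ (h : 1 ≤ m), Mono (K.map' 0 1)
  lift : ∀ (i : ℕ) (hi : i + 1 ≤ m) (P : C) (_ : Projective P) (f : P ⟶ K.obj' (i + 1)),
    IsCocycle K (i + 1) hi f → ∃ g : P ⟶ K.obj' i, g ≫ K.map' i (i + 1) = f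

/-- Every morphism from the syzygy of `Z` to `B` extends to the chosen projective over `Z`; this
expresses that `Ext¹(Z, B) = 0`. -/
def SyzExtends (Z B : C) : Prop :=
  ∀ v : syz Z ⟶ B, ∃ V : Projective.over Z ⟶ B, kernel.ι (Projective.π Z) ≫ V = v

lemma exists_π_comp_eq {Z B : C} (F : Projective.over Z ⟶ B)
    (h : kernel.ι (Projective.π Z) ≫ F = 0) : ∃ f : Z ⟶ B, Projective.π Z ≫ f = F :=
  ⟨Abelian.epiDesc _ F h, Abelian.comp_epiDesc _ F h⟩

lemma exists_π_comp_eq_of_presMap {Z B : C} (F : Projective.over Z ⟶ B)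
    (h : presMap Z ≫ F = 0) : ∃ f : Z ⟶ B, Projective.π Z ≫ f = F :=
  exists_π_comp_eq F (by
    rw [← cancel_epi (Projective.π (syz Z)), comp_zero, ← h, presMap, Category.assoc])

/-- `g` is obtained from `f` by lifting along the projective cover of `Z` and restricting to the
syzygy. -/
def SyzRel (K : ComposableArrows C m) {Z : C} (i : ℕ) (hi : i + 1 ≤ m) (f : Z ⟶ K.obj' (i + 1))
    (g : syz Z ⟶ K.obj' i) : Prop :=
  ∃ F : Projective.over Z ⟶ K.obj' i, F ≫ K.map' i (i + 1) = Projective.π Z ≫ f ∧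
    kernel.ι (Projective.π Z) ≫ F = g

variable {K : ComposableArrows C m} {Z : C}

lemma SyzRel.exists (hK : IsExactSeq K) {i : ℕ} {hi : i + 1 ≤ m} (f : Z ⟶ K.obj' (i + 1))
    (hf : IsCocycle K (i + 1) hi f) : ∃ g, SyzRel K i hi f g := by
  obtain ⟨F, hF⟩ := hK.lift i hi _ inferInstance (Projective.π Z ≫ f)
    (fun h => by rw [Category.assoc, hf h, comp_zero])
  exact ⟨_, F, hF, rfl⟩

lemma SyzRel.isCocycle {i : ℕ} {hi : i + 1 ≤ m} {f : Z ⟶ K.obj' (i + 1)} {g : syz Z ⟶ K.obj' i}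
    (h : SyzRel K i hi f g) : IsCocycle K i (by omega) g := by
  obtain ⟨F, hF, rfl⟩ := h
  intro _
  rw [Category.assoc, hF, kernel.condition_assoc, zero_comp]

/-- Climbing back up: extend `g` to the projective by the vanishing of `Ext¹`; the composite into
`Kᵢ₊₁` kills the syzygy because `g` is a cocycle, so it descends to `Z`. -/
lemma SyzRel.exists_of_isCocycle (hK : IsExactSeq K) {i : ℕ} {hi : i + 1 ≤ m}
    (hE : SyzExtends Z (K.obj' i)) (g : syz Z ⟶ K.obj' i) (hg : IsCocycle K i (by omega) g) :
    ∃ f, SyzRel K i hi f g ∧ IsCocycle K (i + 1) hi f := by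
  obtain ⟨F, rfl⟩ := hE g
  obtain ⟨f, hf⟩ := exists_π_comp_eq (F ≫ K.map' i (i + 1))
    (by rw [← Category.assoc]; exact hg hi)
  refine ⟨f, ⟨F, hf.symm, rfl⟩, fun h => ?_⟩
  rw [← cancel_epi (Projective.π Z), ← Category.assoc, hf, Category.assoc, hK.zero i h, comp_zero,
    comp_zero]

/-- If `f` comes from `w`, then `F` and `π ≫ w` agree after mapping to `Kᵢ₊₂`. Their difference
lifts to `Kᵢ`, and on the syzygy the term `π ≫ w` disappears. -/
lemma SyzRel.isBoundary (hK : IsExactSeq K) {i : ℕ} {hi : i + 1 + 1 ≤ m}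
    {f : Z ⟶ K.obj' (i + 1 + 1)} {g : syz Z ⟶ K.obj' (i + 1)} (h : SyzRel K (i + 1) hi f g)
    (hf : ∃ w : Z ⟶ K.obj' (i + 1), w ≫ K.map' (i + 1) (i + 1 + 1) = f) :
    ∃ v : syz Z ⟶ K.obj' i, v ≫ K.map' i (i + 1) = g := by
  obtain ⟨F, hF, rfl⟩ := h
  obtain ⟨w, rfl⟩ := hf
  obtain ⟨V, hV⟩ := hK.lift i (by omega) _ inferInstance (F - Projective.π Z ≫ w)
    (fun h => by rw [Preadditive.sub_comp, hF, Category.assoc, sub_self])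
  refine ⟨kernel.ι _ ≫ V, ?_⟩
  rw [Category.assoc, hV, Preadditive.comp_sub, kernel.condition_assoc, zero_comp, sub_zero]

/-- The converse needs `Ext¹(Z, Kᵢ) = 0`: after extending `v` to `V` on the projective, `F - V ≫ d`
kills the syzygy and descends to the required `w`. -/
lemma SyzRel.isBoundary_left (hK : IsExactSeq K) {i : ℕ} {hi : i + 1 + 1 ≤ m}
    (hE : SyzExtends Z (K.obj' i))
    {f : Z ⟶ K.obj' (i + 1 + 1)} {g : syz Z ⟶ K.obj' (i + 1)} (h : SyzRel K (i + 1) hi f g)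
    (hg : ∃ v : syz Z ⟶ K.obj' i, v ≫ K.map' i (i + 1) = g) :
    ∃ w : Z ⟶ K.obj' (i + 1), w ≫ K.map' (i + 1) (i + 1 + 1) = f := by
  obtain ⟨F, hF, rfl⟩ := h
  obtain ⟨v, hv⟩ := hg
  obtain ⟨V, rfl⟩ := hE v
  obtain ⟨w, hw⟩ := exists_π_comp_eq (F - V ≫ K.map' i (i + 1))
    (by rw [Preadditive.comp_sub, ← hv, Category.assoc, sub_self])
  refine ⟨w, ?_⟩
  rw [← cancel_epi (Projective.π Z), ← Category.assoc, hw, Preadditive.sub_comp, hF, Category.assoc,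
    hK.zero i hi, comp_zero, sub_zero]

lemma SyzRel.comp {K' : ComposableArrows C m} {Z' : C} (a : Z' ⟶ Z) (φ : K ⟶ K')
    {i : ℕ} {hi : i + 1 ≤ m} {f : Z ⟶ K.obj' (i + 1)} {g : syz Z ⟶ K.obj' i}
    (h : SyzRel K i hi f g) :
    SyzRel K' i hi (a ≫ f ≫ ComposableArrows.app' φ (i + 1) hi)
      (syzMap a ≫ g ≫ ComposableArrows.app' φ i (by omega)) := by
  obtain ⟨F, hF, rfl⟩ := h
  refine ⟨lift₀ a ≫ F ≫ ComposableArrows.app' φ i (by omega), ?_, by simp⟩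
  rw [Category.assoc, Category.assoc, ← ComposableArrows.naturality' φ i (i + 1) (by omega) hi, reassoc_of% hF,
    lift₀_comp_assoc]

section Linear

variable {R : Type u} [CommRing R] [Linear R C]

lemma SyzRel.add {i : ℕ} {hi : i + 1 ≤ m} {f f' : Z ⟶ K.obj' (i + 1) hi}
    {g g' : syz Z ⟶ K.obj' i (Nat.le_of_succ_le hi)}
    (h : SyzRel K i hi f g) (h' : SyzRel K i hi f' g') : SyzRel K i hi (f + f') (g + g') := by
  obtain ⟨F, hF, rfl⟩ := h
  obtain ⟨F', hF', rfl⟩ := h'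
  exact ⟨F + F', by simp [hF, hF'], by simp⟩

lemma SyzRel.smul (r : R) {i : ℕ} {hi : i + 1 ≤ m} {f : Z ⟶ K.obj' (i + 1)}
    {g : syz Z ⟶ K.obj' i} (h : SyzRel K i hi f g) : SyzRel K i hi (r • f) (r • g) := by
  obtain ⟨F, hF, rfl⟩ := h
  exact ⟨r • F, by simp [hF], by simp⟩

end Linear

/-! ### Dimension shifting through several syzygies. -/

/-- The iteration of `SyzRel`: a relation between morphisms from `X` to the last term `Kₘ` and
morphisms from the `k`-th syzygy of `X` to `Kᵢ`, where `i + k = m`. -/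
def SyzIterRel (K : ComposableArrows C m) {X : PStab C} (f : X.as ⟶ K.obj' m) :
    (k i : ℕ) → (hi : i + k = m) → (((syzIter C k).obj X).as ⟶ K.obj' i) → Prop
  | 0, i, hi => fun g => (show X.as ⟶ K.obj' i from g) = f ≫ K.map' m i (by omega)
  | k + 1, i, hi => fun g => ∃ f' : ((syzIter C k).obj X).as ⟶ K.obj' (i + 1),
      SyzIterRel K f k (i + 1) (by omega) f' ∧ SyzRel K i (by omega) f' g

variable {X : PStab C}

lemma map'_refl (K : ComposableArrows C m) (i : ℕ) (hi : i ≤ m) (h : i ≤ i) :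
    K.map' i i h hi = 𝟙 (K.obj' i) := K.map_id _

lemma SyzIterRel.zero_iff {f : X.as ⟶ K.obj' m} (h : m + 0 = m) (g : X.as ⟶ K.obj' m) :
    SyzIterRel K f 0 m h g ↔ g = f := by
  change g = f ≫ K.map' m m _ _ ↔ _
  rw [map'_refl, Category.comp_id]

lemma SyzIterRel.isCocycle {f : X.as ⟶ K.obj' m} {k i : ℕ} {hi : i + k = m}
    {g : ((syzIter C k).obj X).as ⟶ K.obj' i} (h : SyzIterRel K f k i hi g) :
    IsCocycle K i (by omega) g := by
  cases k with
  | zero => exact fun h => absurd h (by omega)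
  | succ k =>
    obtain ⟨f', -, h⟩ := h
    exact h.isCocycle

lemma SyzIterRel.exists (hK : IsExactSeq K) (f : X.as ⟶ K.obj' m) (k i : ℕ) (hi : i + k = m) :
    ∃ g, SyzIterRel K f k i hi g := by
  induction k generalizing i with
  | zero => exact ⟨_, rfl⟩
  | succ k ih =>
    obtain ⟨f', hf'⟩ := ih (i + 1) (by omega)
    obtain ⟨g, hg⟩ := SyzRel.exists hK (hi := by omega) f' hf'.isCocycle
    exact ⟨g, f', hf', hg⟩

/-- The vanishing of `Ext¹(Ωʲ X, Kᵢ)` for `j < k` and `1 ≤ i`. -/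
def SyzIterExtends (K : ComposableArrows C m) (X : PStab C) (k : ℕ) : Prop :=
  ∀ j < k, ∀ (i : ℕ) (_ : 1 ≤ i) (hi : i ≤ m), SyzExtends ((syzIter C j).obj X).as (K.obj' i)

lemma SyzIterRel.exists_of_isCocycle (hK : IsExactSeq K) {k i : ℕ} (hi : i + k = m) (h1 : 1 ≤ i)
    (hE : SyzIterExtends K X k) (g : ((syzIter C k).obj X).as ⟶ K.obj' i)
    (hg : IsCocycle K i (by omega) g) : ∃ f, SyzIterRel K f k i hi g := by
  induction k generalizing i with
  | zero =>
    obtain rfl : i = m := by omega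
    exact ⟨g, (SyzIterRel.zero_iff hi g).2 rfl⟩
  | succ k ih =>
    obtain ⟨f', hf', hc⟩ := SyzRel.exists_of_isCocycle hK (hi := by omega)
      (hE k (by omega) i h1 (by omega)) g hg
    obtain ⟨f, hf⟩ := ih (i := i + 1) (by omega) (by omega)
      (fun j hj => hE j (by omega)) f' hc
    exact ⟨f, f', hf, hf'⟩

/-- The index `e` with `e + 1 = m` names the penultimate term without a truncated subtraction. -/
lemma SyzIterRel.isBoundary (hK : IsExactSeq K) {k i : ℕ} {hi : i + 1 + k = m} (e : ℕ)
    (he : e + 1 = m) {f : X.as ⟶ K.obj' m} {g : ((syzIter C k).obj X).as ⟶ K.obj' (i + 1)}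
    (h : SyzIterRel K f k (i + 1) hi g)
    (hf : ∃ w : X.as ⟶ K.obj' e, w ≫ K.map' e m = f) :
    ∃ v : ((syzIter C k).obj X).as ⟶ K.obj' i, v ≫ K.map' i (i + 1) = g := by
  induction k generalizing i with
  | zero =>
    obtain rfl : i + 1 = m := by omega
    obtain rfl : e = i := by omega
    exact hf.imp fun w hw => hw.trans ((SyzIterRel.zero_iff hi g).1 h).symm
  | succ k ih =>
    obtain ⟨f', hf', h⟩ := h
    exact h.isBoundary hK (ih hf' hf)

lemma SyzIterRel.isBoundary_left (hK : IsExactSeq K) {k i : ℕ} {hi : i + 1 + k = m} (e : ℕ)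
    (he : e + 1 = m) (h1 : 1 ≤ i) (hE : SyzIterExtends K X k)
    {f : X.as ⟶ K.obj' m} {g : ((syzIter C k).obj X).as ⟶ K.obj' (i + 1)}
    (h : SyzIterRel K f k (i + 1) hi g)
    (hg : ∃ v : ((syzIter C k).obj X).as ⟶ K.obj' i, v ≫ K.map' i (i + 1) = g) :
    ∃ w : X.as ⟶ K.obj' e, w ≫ K.map' e m = f := by
  induction k generalizing i with
  | zero =>
    obtain rfl : i + 1 = m := by omega
    obtain rfl : e = i := by omega
    exact hg.imp fun w hw => hw.trans ((SyzIterRel.zero_iff hi g).1 h)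
  | succ k ih =>
    obtain ⟨f', hf', h⟩ := h
    exact ih (by omega) (fun j hj => hE j (by omega)) hf'
      (h.isBoundary_left hK (hE k (by omega) i h1 (by omega)) hg)

/-- Every morphism in the stable category has representatives on all syzygies which are compatible
with `SyzIterRel`. -/
lemma SyzIterRel.exists_comp {K' : ComposableArrows C m} {X' : PStab C} (a : X'.as ⟶ X.as)
    (φ : K ⟶ K') (k : ℕ) :
    ∃ b : ((syzIter C k).obj X').as ⟶ ((syzIter C k).obj X).as,
      (syzIter C k).map ((Quotient.functor (projRel C)).map a : X' ⟶ X) =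
        (Quotient.functor (projRel C)).map b ∧
      ∀ (i : ℕ) (hi : i + k = m) (f : X.as ⟶ K.obj' m) (g : ((syzIter C k).obj X).as ⟶ K.obj' i),
        SyzIterRel K f k i hi g →
        SyzIterRel K' (a ≫ f ≫ ComposableArrows.app' φ m le_rfl) k i hi
          (b ≫ g ≫ ComposableArrows.app' φ i (by omega)) := by
  induction k with
  | zero =>
    refine ⟨a, rfl, fun i hi f g h => ?_⟩
    obtain rfl : i = m := by omega
    have h' := (SyzIterRel.zero_iff hi g).1 h
    subst h'
    exact (SyzIterRel.zero_iff hi _).2 rfl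
  | succ k ih =>
    obtain ⟨b, hb, ih⟩ := ih
    refine ⟨syzMap b, ?_, ?_⟩
    · change (syzFunctor C).map ((syzIter C k).map _) = _
      rw [hb]
      rfl
    · rintro i hi f g ⟨f', hf', h⟩
      exact ⟨_, ih _ _ _ _ hf', h.comp b φ⟩

section Linear

variable {R : Type u} [CommRing R] [Linear R C]

lemma SyzIterRel.zero (k i : ℕ) (hi : i + k = m) :
    SyzIterRel K (0 : X.as ⟶ K.obj' m) k i hi 0 := by
  induction k generalizing i with
  | zero => exact zero_comp.symm
  | succ k ih => exact ⟨0, ih _ _, 0, by simp only [zero_comp, comp_zero], comp_zero⟩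

lemma SyzIterRel.add {k i : ℕ} {hi : i + k = m} {f f' : X.as ⟶ K.obj' m le_rfl}
    {g g' : ((syzIter C k).obj X).as ⟶ K.obj' i (hi ▸ Nat.le_add_right i k)} (h : SyzIterRel K f k i hi g)
    (h' : SyzIterRel K f' k i hi g') : SyzIterRel K (f + f') k i hi (g + g') := by
  induction k generalizing i with
  | zero =>
    obtain rfl : i = m := by omega
    have h := (SyzIterRel.zero_iff hi g).1 h
    have h' := (SyzIterRel.zero_iff hi g').1 h'
    subst h h'
    exact (SyzIterRel.zero_iff hi _).2 rfl
  | succ k ih =>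
    obtain ⟨p, hp, h⟩ := h
    obtain ⟨p', hp', h'⟩ := h'
    exact ⟨_, ih hp hp', h.add h'⟩

lemma SyzIterRel.smul (r : R) {k i : ℕ} {hi : i + k = m} {f : X.as ⟶ K.obj' m}
    {g : ((syzIter C k).obj X).as ⟶ K.obj' i} (h : SyzIterRel K f k i hi g) :
    SyzIterRel K (r • f) k i hi (r • g) := by
  induction k generalizing i with
  | zero =>
    obtain rfl : i = m := by omega
    have h := (SyzIterRel.zero_iff hi g).1 h
    subst h
    exact (SyzIterRel.zero_iff hi _).2 rfl
  | succ k ih =>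
    obtain ⟨p, hp, h⟩ := h
    exact ⟨_, ih hp, h.smul r⟩

end Linear

end SyzygyRelation

/-! ### Chain maps from the projective resolution to an exact sequence. -/

section ResolutionRelation

variable {C : Type v} [Category.{w} C] [Abelian C] [EnoughProjectives C] {e : ℕ}

/-- For a morphism `f` from `X` to the last term of `K`, the morphisms from the `(e + 1)`-st term
of the projective resolution of `X` to the first term of `K` that are part of a morphism of
complexes over `f`. -/
def ResRel (K : ComposableArrows C (e + 1 + 1)) {X : PStab C} (f : X.as ⟶ K.obj' (e + 1 + 1))
    (g : Projective.over (syz ((syzIter C e).obj X).as) ⟶ K.obj' 0) : Prop :=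
  ∃ f' : ((syzIter C e).obj X).as ⟶ K.obj' 2, SyzIterRel K f e 2 (by omega) f' ∧
    ∃ F : Projective.over ((syzIter C e).obj X).as ⟶ K.obj' 1,
      F ≫ K.map' 1 2 = Projective.π _ ≫ f' ∧ g ≫ K.map' 0 1 = presMap _ ≫ F

variable {K : ComposableArrows C (e + 1 + 1)} {X : PStab C}

lemma ResRel.exists (hK : IsExactSeq K) (f : X.as ⟶ K.obj' (e + 1 + 1)) : ∃ g, ResRel K f g := by
  obtain ⟨f', hf'⟩ := SyzIterRel.exists hK f e 2 (by omega)
  obtain ⟨F, hF⟩ := hK.lift 1 (by omega) _ inferInstance (Projective.π _ ≫ f')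
    (fun h => by rw [Category.assoc, hf'.isCocycle h, comp_zero])
  obtain ⟨g, hg⟩ := hK.lift 0 (by omega) _ inferInstance (presMap _ ≫ F)
    (fun h => by
      rw [Category.assoc]
      erw [hF]
      rw [← Category.assoc, presMap_π, zero_comp])
  exact ⟨g, f', hf', F, hF, hg⟩

/-- Describes the possible last components `g`: those that die in `Hom(P₁, K₁)` modulo maps
factoring through `P₁ ⟶ P₀`. For such `g`, the map `F` followed by `K₁ ⟶ K₂` descends to a cocycle
on `Ωᵉ X`, and the vanishing of `Ext` carries it up to `X`. -/
lemma ResRel.exists_of_comp (hK : IsExactSeq K) (hE : SyzIterExtends K X e)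
    (g : Projective.over (syz ((syzIter C e).obj X).as) ⟶ K.obj' 0)
    (hg : ∃ F : Projective.over ((syzIter C e).obj X).as ⟶ K.obj' 1,
      g ≫ K.map' 0 1 = presMap _ ≫ F) : ∃ f, ResRel K f g := by
  obtain ⟨F, hF⟩ := hg
  obtain ⟨f', hf'⟩ := exists_π_comp_eq_of_presMap (F ≫ K.map' 1 2) (by
    rw [← Category.assoc, ← hF, Category.assoc]
    erw [hK.zero 0 (by omega)]
    rw [comp_zero])
  obtain ⟨f, hf⟩ := SyzIterRel.exists_of_isCocycle (X := X) hK (i := 2) (k := e) (by omega)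
    (by omega) hE f' (fun h => by
      rw [← cancel_epi (Projective.π _), ← Category.assoc, hf', Category.assoc]
      erw [hK.zero 1 h]
      rw [comp_zero, comp_zero])
  exact ⟨f, f', hf, F, hf'.symm, hF⟩

/-- A chain map over a boundary is null-homotopic; `a` is the part of the homotopy that remains in
the last degree, since `K₀` receives nothing from the left. -/
lemma ResRel.eq_presMap_comp (hK : IsExactSeq K) {f : X.as ⟶ K.obj' (e + 1 + 1)}
    {g : Projective.over (syz ((syzIter C e).obj X).as) ⟶ K.obj' 0} (h : ResRel K f g)
    (hf : ∃ w : X.as ⟶ K.obj' (e + 1), w ≫ K.map' (e + 1) (e + 1 + 1) = f) :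
    ∃ a, g = presMap _ ≫ a := by
  obtain ⟨f', hf', F, hF, hg⟩ := h
  obtain ⟨w, rfl⟩ := hf'.isBoundary hK (i := 1) (e + 1) rfl hf
  obtain ⟨a, ha⟩ := hK.lift 0 (by omega) _ inferInstance (F - Projective.π _ ≫ w)
    (fun h => by
      rw [Preadditive.sub_comp, Category.assoc]
      exact sub_eq_zero.2 hF)
  refine ⟨a, ?_⟩
  have := hK.mono (by omega)
  rw [← cancel_mono (K.map' 0 1 _ _), hg, Category.assoc]
  erw [ha]
  rw [Preadditive.comp_sub, ← Category.assoc, presMap_π, zero_comp, sub_zero]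

/-- The converse. The last step works with `P₁ ⟶ P₀` in place of an extension property, because
`Ext¹(Ωᵉ X, K₀)` need not vanish. -/
lemma ResRel.isBoundary_left (hK : IsExactSeq K) (hE : SyzIterExtends K X e)
    {f : X.as ⟶ K.obj' (e + 1 + 1)} {a : Projective.over ((syzIter C e).obj X).as ⟶ K.obj' 0}
    (h : ResRel K f (presMap _ ≫ a)) :
    ∃ w : X.as ⟶ K.obj' (e + 1), w ≫ K.map' (e + 1) (e + 1 + 1) = f := by
  obtain ⟨f', hf', F, hF, hg⟩ := h
  refine hf'.isBoundary_left hK (i := 1) (e + 1) rfl le_rfl hE ?_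
  -- Changing `F` by the homotopy `a` makes the last component zero, so that the corrected `F`
  -- factors through `Ωᵉ X`.
  obtain ⟨w, hw⟩ := exists_π_comp_eq_of_presMap (F - a ≫ K.map' 0 1) (by
    rw [Preadditive.comp_sub, ← hg, Category.assoc, sub_self])
  refine ⟨w, ?_⟩
  rw [← cancel_epi (Projective.π _), ← Category.assoc, hw, Preadditive.sub_comp, Category.assoc]
  erw [hK.zero 0 (by omega)]
  rw [comp_zero, sub_zero]
  exact hF

lemma ResRel.presMap_comp (a : Projective.over ((syzIter C e).obj X).as ⟶ K.obj' 0)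
    (hK : IsExactSeq K) (hE : SyzIterExtends K X e) :
    ∃ f, ResRel K f (presMap _ ≫ a) :=
  exists_of_comp hK hE _ ⟨a ≫ K.map' 0 1, Category.assoc _ _ _⟩

/-- One morphism `b` represents the stable class of `Ωᵉ a` and works for all `f` and `g` at once;
naturality of the comparison map rests on this. -/
lemma ResRel.exists_comp {K' : ComposableArrows C (e + 1 + 1)} {X' : PStab C} (a : X'.as ⟶ X.as)
    (φ : K ⟶ K') :
    ∃ b : ((syzIter C e).obj X').as ⟶ ((syzIter C e).obj X).as,
      (syzIter C e).map ((Quotient.functor (projRel C)).map a : X' ⟶ X) =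
        (Quotient.functor (projRel C)).map b ∧
      ∀ (f : X.as ⟶ K.obj' (e + 1 + 1))
        (g : Projective.over (syz ((syzIter C e).obj X).as) ⟶ K.obj' 0), ResRel K f g →
        ResRel K' (a ≫ f ≫ ComposableArrows.app' φ (e + 1 + 1))
          (lift₁ b ≫ g ≫ ComposableArrows.app' φ 0) := by
  obtain ⟨b, hb, H⟩ := SyzIterRel.exists_comp (X := X) a φ e
  refine ⟨b, hb, ?_⟩
  rintro f g ⟨f', hf', F, hF, hg⟩
  refine ⟨_, H _ _ _ _ hf', lift₀ b ≫ F ≫ ComposableArrows.app' φ 1, ?_, ?_⟩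
  · rw [Category.assoc, Category.assoc, ← ComposableArrows.naturality' φ 1 2, reassoc_of% hF,
      lift₀_comp_assoc]
  · rw [Category.assoc, Category.assoc, ← ComposableArrows.naturality' φ 0 1, reassoc_of% hg,
      lift₁_comp_assoc]

variable (R : Type u) [CommRing R] [Linear R C]

variable (K X) in
/-- `ResRel` as a submodule. -/
def resSubmodule : Submodule R ((X.as ⟶ K.obj' (e + 1 + 1)) ×
    (Projective.over (syz ((syzIter C e).obj X).as) ⟶ K.obj' 0)) where
  carrier := {p | ResRel K p.1 p.2}
  add_mem' := by
    rintro ⟨f, g⟩ ⟨p, q⟩ ⟨f', hf', F, hF, hg⟩ ⟨p', hp', P, hP, hq⟩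
    refine ⟨_, hf'.add hp', F + P, ?_, ?_⟩
    · rw [Preadditive.add_comp, hF, hP, Preadditive.comp_add]
    · rw [Preadditive.comp_add, ← hg, ← hq]
      exact Preadditive.add_comp _ _ _ _ _ _
  zero_mem' := ⟨0, SyzIterRel.zero _ _ _, 0, by rw [zero_comp, comp_zero],
    zero_comp.trans comp_zero.symm⟩
  smul_mem' := by
    rintro r ⟨f, g⟩ ⟨f', hf', F, hF, hg⟩
    refine ⟨_, hf'.smul r, r • F, ?_, ?_⟩
    · rw [Linear.smul_comp, hF, Linear.comp_smul]
    · rw [Linear.comp_smul, ← hg]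
      exact Linear.smul_comp _ _ _ _ _ _

end ResolutionRelation

/-! ### Vanishing of Ext and extension of morphisms from syzygies. -/

section SyzygyExt

variable {A : Type u} [Ring A]

/-- Projectivity among finitely generated modules passes to all modules because such a module is a
retract of a finite free one. -/
lemma projective_obj_of_projective (P : FGModuleCat.{u} A) [hP : Projective P] :
    Projective P.obj := by
  obtain ⟨n, p, hp⟩ := exists_fgFree_epi P
  have : Projective (fgFree A n).obj := ModuleCat.projective_of_free (Pi.basisFun A (Fin n))
  exact Retract.projective (Y := (fgFree A n).obj) ⟨(Projective.factorThru (𝟙 P) p).hom, p.hom,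
    congrArg (fun k => k.hom) (Projective.factorThru_comp (𝟙 P) p)⟩

variable [IsNoetherianRing A]

/-- The sequence `0 ⟶ ΩZ ⟶ P ⟶ Z ⟶ 0` as a sequence of modules. -/
noncomputable def syzSequence (Z : FGModuleCat.{u} A) : ShortComplex (ModuleCat.{u} A) :=
  ShortComplex.mk (kernel.ι (Projective.π Z)).hom (Projective.π Z).hom
    (congrArg (fun k => k.hom) (kernel.condition (Projective.π Z)))

lemma syzSequence_shortExact (Z : FGModuleCat.{u} A) : (syzSequence Z).ShortExact where
  exact := by
    rw [ShortComplex.moduleCat_exact_iff]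
    intro x hx
    -- The element `x` is encoded as a morphism from the regular module, so that the universal
    -- property of the kernel among finitely generated modules applies.
    let f : FGModuleCat.of A A ⟶ (Projective.over Z : FGModuleCat.{u} A) :=
      FGModuleCat.ofHom (LinearMap.toSpanSingleton A (Projective.over Z : FGModuleCat.{u} A)
        (show (Projective.over Z : FGModuleCat.{u} A) from x))
    have hf : f ≫ Projective.π Z = 0 := by
      apply FGModuleCat.hom_ext
      ext
      change (Projective.π Z).hom.hom ((1 : A) • x) = 0
      rw [one_smul]
      exact hx
    refine ⟨(kernel.lift _ f hf).hom.hom (1 : A), ?_⟩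
    have h : f.hom.hom (1 : A) = x := one_smul A x
    rw [← h]
    conv_rhs => rw [← kernel.lift_ι _ f hf]
    rfl
  mono_f := (ModuleCat.mono_iff_injective _).2 (fg_injective_of_mono (kernel.ι (Projective.π Z)))
  epi_g := (ModuleCat.epi_iff_surjective _).2 (fg_surjective_of_epi (Projective.π Z))

/-- Exactness of `Hom(P, B) ⟶ Hom(ΩZ, B) ⟶ Ext¹(Z, B)`. -/
lemma syzExtends_of_ext (Z B : FGModuleCat.{u} A)
    (h : Subsingleton (Abelian.Ext.{u} Z.obj B.obj 1)) : SyzExtends Z B := by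
  intro v
  have : Subsingleton (Abelian.Ext.{u} (syzSequence Z).X₃ B.obj 1) := h
  obtain ⟨y, hy⟩ := Abelian.Ext.contravariant_sequence_exact₁ (syzSequence_shortExact Z) B.obj
    (Abelian.Ext.mk₀ (X := (syz Z).obj) (Y := B.obj) v.hom) (n₁ := 1) rfl (Subsingleton.elim _ _)
  obtain ⟨V, rfl⟩ := (Abelian.Ext.mk₀_bijective _ _).2 y
  refine ⟨⟨V⟩, ObjectProperty.hom_ext _ ((Abelian.Ext.mk₀_bijective _ _).1 ?_)⟩
  rw [← hy]
  exact (Abelian.Ext.mk₀_comp_mk₀ _ _).symm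

/-- Exactness of `Extᵏ⁺¹(P, B) ⟶ Extᵏ⁺¹(ΩZ, B) ⟶ Extᵏ⁺²(Z, B)`, whose outer terms vanish. -/
lemma ext_syz_subsingleton (Z B : FGModuleCat.{u} A) (k : ℕ)
    (h : Subsingleton (Abelian.Ext.{u} Z.obj B.obj (k + 2))) :
    Subsingleton (Abelian.Ext.{u} (syz Z).obj B.obj (k + 1)) := by
  have := projective_obj_of_projective (Projective.over Z)
  have : Subsingleton (Abelian.Ext.{u} (syzSequence Z).X₃ B.obj (k + 2)) := h
  refine subsingleton_of_forall_eq 0 fun x => ?_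
  obtain ⟨y, rfl⟩ := Abelian.Ext.contravariant_sequence_exact₁ (syzSequence_shortExact Z) B.obj
    x (n₁ := k + 2) (by omega) (Subsingleton.elim _ _)
  have hy : y = 0 := Abelian.Ext.eq_zero_of_projective (P := (Projective.over Z).obj) y
  rw [hy]
  exact Abelian.Ext.comp_zero _ _ _ _ _

lemma ext_syzIter_subsingleton (X : PStab (FGModuleCat.{u} A)) (B : FGModuleCat.{u} A) (j k : ℕ)
    (h : Subsingleton (Abelian.Ext.{u} X.as.obj B.obj (k + 1 + j))) :
    Subsingleton
      (Abelian.Ext.{u} ((syzIter (FGModuleCat.{u} A) j).obj X).as.obj B.obj (k + 1)) := by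
  induction j generalizing k with
  | zero => exact h
  | succ j ih =>
    exact ext_syz_subsingleton _ B k (ih (k + 1) (by convert h using 2; omega))

end SyzygyExt

/-! ### A `d`-exact sequence in a cluster-tilting subcategory as an exact sequence of modules. -/

section DExactSequence

variable {A : Type u} [Ring A] [IsNoetherianRing A] {d : ℕ}
  {M : ObjectProperty (FGModuleCat.{u} A)}

/-- The sequence of modules underlying a `d`-exact sequence. -/
def DEx.seq : DEx d M.FullSubcategory ⥤ ComposableArrows (FGModuleCat.{u} A) (d + 1) :=
  (isDExact d M.FullSubcategory).ι ⋙ M.ι.mapComposableArrows (d + 1)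

lemma DEx.seq_isExactSeq (hM : IsClusterTilting d M) (δ : DEx d M.FullSubcategory)
    (hmono : Mono (δ.obj.map' 0 1).hom) (hepi : Epi (δ.obj.map' d (d + 1)).hom) :
    IsExactSeq (DEx.seq.obj δ) where
  zero i hi := congrArg (fun k => k.hom) (δ.property.1.isComplex.zero i)
  mono _ := hmono
  lift i hi P hP f hf := by
    by_cases h : i + 2 ≤ d + 1
    -- Left `d`-exactness is tested on objects of `M` only, hence on a free cover of `P`; a section
    -- of the cover carries the lift back to `P`.
    · obtain ⟨n, p, hp⟩ := exists_fgFree_epi P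
      let F : M.FullSubcategory := ⟨fgFree A n, hM.fgFree_mem n⟩
      obtain ⟨g, hg⟩ := δ.property.1.exact i h F (ObjectProperty.homMk (p ≫ f)) (by
        apply ObjectProperty.hom_ext
        change (p ≫ f) ≫ _ = 0
        exact (Category.assoc _ _ _).trans ((congrArg (p ≫ ·) (hf h)).trans comp_zero))
      refine ⟨Projective.factorThru (𝟙 P) p ≫ g.hom, (Category.assoc _ _ _).trans ?_⟩
      have hg' : g.hom ≫ (DEx.seq.obj δ).map' i (i + 1) = p ≫ f := congrArg (fun k => k.hom) hg
      refine (congrArg (_ ≫ ·) hg').trans ?_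
      rw [← Category.assoc, Projective.factorThru_comp, Category.id_comp]
    -- At the last term there is no cocycle condition, and surjectivity of the last map provides the
    -- lift.
    · obtain rfl : i = d := by omega
      let p := (δ.obj.map' i (i + 1)).hom
      have : Epi p := hepi
      let f' : P ⟶ (δ.obj.obj' (i + 1)).obj := f
      have h := Projective.factorThru_comp f' p
      exact ⟨_, h⟩

/-- `Ext¹(Ωʲ X, Kᵢ)` is controlled by `Extʲ⁺¹(X, Kᵢ)`, and `1 ≤ j + 1 ≤ e = d - 1` is exactly the
range in which cluster tilting gives zero. -/
lemma DEx.syzIterExtends {e : ℕ} (hM : IsClusterTilting (e + 1) M)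
    (δ : DEx (e + 1) M.FullSubcategory) (X : PStab (FGModuleCat.{u} A)) (hX : M X.as) :
    SyzIterExtends (DEx.seq.obj δ) X e := fun j hj i h1 hi =>
  syzExtends_of_ext _ _ (ext_syzIter_subsingleton X _ j 0 ((hM.mem_iff_left X.as).1 hX _
    (by omega) (by omega) _ (δ.obj.obj' i).property))

end DExactSequence

/-! ### Functionals with values in an injective module. -/

section Extension

variable {R : Type*} [CommRing R] {I : Type u} [AddCommGroup I] [Module R I]

/-- The quotient of `T` by `ker p` embeds in `A`, and `I` is injective. Applied to the projections
of a linear relation, this transports functionals from one side to the other; it is how exactness of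
`D` enters. -/
lemma exists_comp_eq_of_ker_le [Module.Injective R I] {T A : Type u}
    [AddCommGroup T] [Module R T] [AddCommGroup A] [Module R A] (p : T →ₗ[R] A) (φ : T →ₗ[R] I)
    (h : LinearMap.ker p ≤ LinearMap.ker φ) : ∃ θ : A →ₗ[R] I, θ ∘ₗ p = φ := by
  obtain ⟨θ, hθ⟩ := Module.Injective.out ((LinearMap.ker p).liftQ p le_rfl)
    (LinearMap.ker_eq_bot.1 (Submodule.ker_liftQ_eq_bot _ _ _ le_rfl))
    ((LinearMap.ker p).liftQ φ h)
  exact ⟨θ, LinearMap.ext fun x => hθ ((LinearMap.ker p).mkQ x)⟩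

end Extension

/-! ### Dual bases and the pairing behind `Hom(L, DN) ≅ D(L ⊗ N)`. -/

section Pairing

variable {R : Type u} [CommRing R] {Λ : Type u} [Ring Λ] [Algebra R Λ]
variable {I : Type u} [AddCommGroup I] [Module R I]
variable {P P' L N N' : Type u}
  [AddCommGroup P] [Module Λᵐᵒᵖ P] [AddCommGroup P'] [Module Λᵐᵒᵖ P']
  [AddCommGroup L] [Module R L] [Module Λᵐᵒᵖ L] [IsScalarTower R Λᵐᵒᵖ L]
  [AddCommGroup N] [Module R N] [Module Λ N] [IsScalarTower R Λ N]
  [AddCommGroup N'] [Module R N'] [Module Λ N'] [IsScalarTower R Λ N']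

/-- A finite dual basis of a right module. -/
structure DualBasis (Λ P : Type u) [Ring Λ] [AddCommGroup P] [Module Λᵐᵒᵖ P] where
  /-- The number of elements. -/
  n : ℕ
  /-- The generators. -/
  x : Fin n → P
  /-- The coordinates. -/
  c : Fin n → (P →ₗ[Λᵐᵒᵖ] Λ)
  sum_eq : ∀ y, ∑ i, MulOpposite.op (c i y) • x i = y

/-- The map `y ↦ l · c(y)`. -/
def rankOne (l : L) (c : P →ₗ[Λᵐᵒᵖ] Λ) : P →ₗ[Λᵐᵒᵖ] L where
  toFun y := MulOpposite.op (c y) • l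
  map_add' y z := by rw [map_add, MulOpposite.op_add, add_smul]
  map_smul' a y := by rw [map_smul, RingHom.id_apply, smul_smul]; rfl

lemma rankOne_apply (l : L) (c : P →ₗ[Λᵐᵒᵖ] Λ) (y : P) :
    rankOne l c y = MulOpposite.op (c y) • l := rfl

lemma rankOne_comp (l : L) (c : P →ₗ[Λᵐᵒᵖ] Λ) (a : P' →ₗ[Λᵐᵒᵖ] P) :
    rankOne l c ∘ₗ a = rankOne l (c ∘ₗ a) := rfl

lemma rankOne_add_left (l l' : L) (c : P →ₗ[Λᵐᵒᵖ] Λ) :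
    rankOne (l + l') c = rankOne l c + rankOne l' c :=
  LinearMap.ext fun _ => smul_add _ _ _

lemma rankOne_add_right (l : L) (c c' : P →ₗ[Λᵐᵒᵖ] Λ) :
    rankOne l (c + c') = rankOne l c + rankOne l c' :=
  LinearMap.ext fun y => by
    rw [rankOne_apply, LinearMap.add_apply, MulOpposite.op_add, add_smul]; rfl

lemma rankOne_smul_left (a : Λ) (l : L) (c : P →ₗ[Λᵐᵒᵖ] Λ) :
    rankOne (MulOpposite.op a • l) c = rankOne l (a • c) :=
  LinearMap.ext fun y => by
    rw [rankOne_apply, rankOne_apply, smul_smul]; rfl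

lemma rankOne_algebraMap_smul (r : R) (l : L) (c : P →ₗ[Λᵐᵒᵖ] Λ) :
    rankOne l (algebraMap R Λ r • c) = r • rankOne l c :=
  LinearMap.ext fun y => by
    rw [rankOne_apply, LinearMap.smul_apply, LinearMap.smul_apply, rankOne_apply, ← smul_assoc,
      smul_eq_mul, ← Algebra.smul_def, MulOpposite.op_smul]

variable (b : DualBasis Λ P)

/-- This replaces `L ⊗ Hom(P, Λ) ≅ Hom(P, L)`: the maps `rankOne l c` play the role of pure tensors.
-/
lemma DualBasis.sum_rankOne (g : P →ₗ[Λᵐᵒᵖ] L) : ∑ i, rankOne (g (b.x i)) (b.c i) = g :=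
  LinearMap.ext fun y => by
    conv_rhs => rw [← b.sum_eq y, map_sum]
    rw [LinearMap.sum_apply]
    exact Finset.sum_congr rfl fun i _ => (map_smul g _ _).symm

lemma DualBasis.sum_rankOne_comp (g : P →ₗ[Λᵐᵒᵖ] L) (a : P' →ₗ[Λᵐᵒᵖ] P) :
    ∑ i, rankOne (g (b.x i)) (b.c i ∘ₗ a) = g ∘ₗ a := by
  conv_rhs => rw [← b.sum_rankOne g]
  refine LinearMap.ext fun y => ?_
  rw [LinearMap.sum_apply, LinearMap.comp_apply, LinearMap.sum_apply]
  rfl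

lemma DualBasis.sum_smul (c : P →ₗ[Λᵐᵒᵖ] Λ) : ∑ i, c (b.x i) • b.c i = c :=
  LinearMap.ext fun y => by
    conv_rhs => rw [← b.sum_eq y, map_sum]
    rw [LinearMap.sum_apply]
    exact Finset.sum_congr rfl fun i _ => (map_smul c _ _).symm

/-- The pairing `(h, g) ↦ ∑ h(g(xᵢ))(q(cᵢ))`, for a map `q` from `Hom_Λ(P, Λ)` to `N`. -/
def DualBasis.pair (q : (P →ₗ[Λᵐᵒᵖ] Λ) →ₗ[Λ] N) (h : L →ₗ[Λᵐᵒᵖ] DualMod R Λ I N) :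
    (P →ₗ[Λᵐᵒᵖ] L) →ₗ[R] I where
  toFun g := ∑ i, (h (g (b.x i))).toHom (q (b.c i))
  map_add' g g' := by
    rw [← Finset.sum_add_distrib]
    refine Finset.sum_congr rfl fun i _ => ?_
    rw [LinearMap.add_apply, map_add]
    rfl
  map_smul' r g := by
    rw [RingHom.id_apply, Finset.smul_sum]
    refine Finset.sum_congr rfl fun i _ => ?_
    rw [LinearMap.smul_apply, LinearMap.map_smul_of_tower]
    rfl

lemma DualBasis.pair_apply (q : (P →ₗ[Λᵐᵒᵖ] Λ) →ₗ[Λ] N) (h : L →ₗ[Λᵐᵒᵖ] DualMod R Λ I N)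
    (g : P →ₗ[Λᵐᵒᵖ] L) : b.pair q h g = ∑ i, (h (g (b.x i))).toHom (q (b.c i)) := rfl

lemma DualBasis.pair_add_left (q : (P →ₗ[Λᵐᵒᵖ] Λ) →ₗ[Λ] N)
    (h h' : L →ₗ[Λᵐᵒᵖ] DualMod R Λ I N) (g : P →ₗ[Λᵐᵒᵖ] L) :
    b.pair q (h + h') g = b.pair q h g + b.pair q h' g := by
  rw [b.pair_apply, b.pair_apply, b.pair_apply, ← Finset.sum_add_distrib]
  rfl

/-- The map `h'` stands for `r • h`; the hypothesis `hh` expresses that `R` acts on the dual through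
`Λ`. -/
lemma DualBasis.pair_smul_left (q : (P →ₗ[Λᵐᵒᵖ] Λ) →ₗ[Λ] N) (r : R)
    (h h' : L →ₗ[Λᵐᵒᵖ] DualMod R Λ I N)
    (hh : ∀ l x, (h' l).toHom x = (h l).toHom (algebraMap R Λ r • x)) (g : P →ₗ[Λᵐᵒᵖ] L) :
    b.pair q h' g = r • b.pair q h g := by
  rw [b.pair_apply, b.pair_apply, Finset.smul_sum]
  refine Finset.sum_congr rfl fun i _ => ?_
  rw [hh, algebraMap_smul, map_smul]

/-- The value on pure tensors does not involve the dual basis. The pairing is therefore independent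
of it, and the identities below reduce to rank-one maps. -/
lemma DualBasis.pair_rankOne (q : (P →ₗ[Λᵐᵒᵖ] Λ) →ₗ[Λ] N) (h : L →ₗ[Λᵐᵒᵖ] DualMod R Λ I N)
    (l : L) (c : P →ₗ[Λᵐᵒᵖ] Λ) : b.pair q h (rankOne l c) = (h l).toHom (q c) := by
  conv_rhs => rw [← b.sum_smul c, map_sum, map_sum]
  rw [b.pair_apply]
  refine Finset.sum_congr rfl fun i _ => ?_
  rw [rankOne_apply, map_smul h, DualMod.smul_toHom, map_smul q]

lemma DualBasis.pair_comp_eq_zero {P₀ : Type u} [AddCommGroup P₀] [Module Λᵐᵒᵖ P₀]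
    (b₀ : DualBasis Λ P₀) (q : (P →ₗ[Λᵐᵒᵖ] Λ) →ₗ[Λ] N) (h : L →ₗ[Λᵐᵒᵖ] DualMod R Λ I N)
    (a : P →ₗ[Λᵐᵒᵖ] P₀) (ha : ∀ c : P₀ →ₗ[Λᵐᵒᵖ] Λ, q (c ∘ₗ a) = 0) (g : P₀ →ₗ[Λᵐᵒᵖ] L) :
    b.pair q h (g ∘ₗ a) = 0 := by
  rw [← b₀.sum_rankOne_comp, map_sum]
  refine Finset.sum_eq_zero fun i _ => ?_
  rw [b.pair_rankOne, ha, map_zero]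

lemma DualBasis.pair_lcomp (b' : DualBasis Λ P') (q : (P →ₗ[Λᵐᵒᵖ] Λ) →ₗ[Λ] N)
    (q' : (P' →ₗ[Λᵐᵒᵖ] Λ) →ₗ[Λ] N') (h : L →ₗ[Λᵐᵒᵖ] DualMod R Λ I N)
    (a : P →ₗ[Λᵐᵒᵖ] P') (t : N' →ₗ[Λ] N) (ht : ∀ c, t (q' c) = q (c ∘ₗ a)) (g : P' →ₗ[Λᵐᵒᵖ] L) :
    b'.pair q' (DualMod.lcomp R Λ I N' t ∘ₗ h) g = b.pair q h (g ∘ₗ a) := by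
  rw [← b'.sum_rankOne_comp, map_sum]
  conv_lhs => rw [← b'.sum_rankOne g]
  rw [map_sum]
  refine Finset.sum_congr rfl fun i _ => ?_
  rw [b.pair_rankOne, b'.pair_rankOne, ← ht]
  rfl

lemma DualBasis.eq_zero_of_pair (q : (P →ₗ[Λᵐᵒᵖ] Λ) →ₗ[Λ] N) (hq : Function.Surjective q)
    (h : L →ₗ[Λᵐᵒᵖ] DualMod R Λ I N) (h0 : ∀ g, b.pair q h g = 0) : h = 0 :=
  LinearMap.ext fun l => LinearMap.ext fun x => by
    obtain ⟨c, rfl⟩ := hq x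
    exact (b.pair_rankOne q h l c).symm.trans (h0 _)

/-- The value on rank-one maps forces `h(l)(q c) = θ(rankOne l c)`. This is well defined because
`ker q` consists of maps `c₀ ∘ a`, for which `rankOne l (c₀ ∘ a)` factors through `a` and is killed
by `θ`. -/
lemma DualBasis.exists_pair_eq {P₀ : Type u} [AddCommGroup P₀] [Module Λᵐᵒᵖ P₀]
    (q : (P →ₗ[Λᵐᵒᵖ] Λ) →ₗ[Λ] N) (hq : Function.Surjective q) (a : P →ₗ[Λᵐᵒᵖ] P₀)
    (ha : ∀ c, q c = 0 → ∃ c₀ : P₀ →ₗ[Λᵐᵒᵖ] Λ, c₀ ∘ₗ a = c) (θ : (P →ₗ[Λᵐᵒᵖ] L) →ₗ[R] I)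
    (hθ : ∀ g : P₀ →ₗ[Λᵐᵒᵖ] L, θ (g ∘ₗ a) = 0) :
    ∃ h : L →ₗ[Λᵐᵒᵖ] DualMod R Λ I N, ∀ g, b.pair q h g = θ g := by
  have key (l : L) : ∃ t : N →ₗ[R] I, ∀ c, t (q c) = θ (rankOne l c) := by
    -- The section `s` of `q` need not be linear; `hs` shows that the choice does not affect the
    -- value of `θ`, and linearity follows from this.
    let s := Function.surjInv hq
    have hs (c : P →ₗ[Λᵐᵒᵖ] Λ) (x : N) (hc : q c = x) : θ (rankOne l c) = θ (rankOne l (s x)) := by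
      obtain ⟨c₀, hc₀⟩ := ha (c - s x) (by
        rw [map_sub, hc, Function.surjInv_eq hq x, sub_self])
      have h1 : rankOne l c = rankOne l c₀ ∘ₗ a + rankOne l (s x) := by
        rw [rankOne_comp, hc₀, ← rankOne_add_right, sub_add_cancel]
      rw [h1, map_add, hθ, zero_add]
    refine ⟨{ toFun := fun x => θ (rankOne l (s x))
              map_add' := fun x y => ?_
              map_smul' := fun r x => ?_ }, fun c => (hs c _ rfl).symm⟩
    · rw [← map_add, ← rankOne_add_right]
      refine (hs _ _ ?_).symm
      rw [map_add, Function.surjInv_eq hq, Function.surjInv_eq hq]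
    · rw [RingHom.id_apply, ← map_smul, ← rankOne_algebraMap_smul]
      refine (hs _ _ ?_).symm
      rw [map_smul, Function.surjInv_eq hq, algebraMap_smul]
  choose t ht using key
  let h : L →ₗ[Λᵐᵒᵖ] DualMod R Λ I N :=
    { toFun := fun l => t l
      map_add' := fun l l' => LinearMap.ext fun x => by
        obtain ⟨c, rfl⟩ := hq x
        refine (ht _ c).trans ?_
        rw [rankOne_add_left, map_add, ← ht, ← ht]
        rfl
      map_smul' := fun a l => LinearMap.ext fun x => by
        obtain ⟨c, rfl⟩ := hq x
        refine (ht _ c).trans ?_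
        obtain ⟨a, rfl⟩ := MulOpposite.op_surjective a
        rw [rankOne_smul_left, ← ht, map_smul]
        rfl }
  refine ⟨h, fun g => ?_⟩
  rw [← b.sum_rankOne g, map_sum, map_sum]
  refine Finset.sum_congr rfl fun i _ => ?_
  rw [b.pair_rankOne]
  exact ht _ _

lemma nonempty_dualBasis (P : FGModuleCat.{u} Λᵐᵒᵖ) [Projective P] :
    Nonempty (DualBasis Λ P) := by
  obtain ⟨n, p, hp⟩ := exists_fgFree_epi P
  let s := Projective.factorThru (𝟙 P) p
  let o : Λᵐᵒᵖ →ₗ[Λᵐᵒᵖ] Λ :=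
    { toFun := MulOpposite.unop
      map_add' := fun _ _ => rfl
      map_smul' := fun _ _ => rfl }
  -- For a split cover `p` of `P` by a free module with section `s`, the generators are the images
  -- of the standard basis and the coordinates are those of `s`.
  refine ⟨⟨n, fun i => p.hom.hom (Pi.single (M := fun _ : Fin n => Λᵐᵒᵖ) i 1),
    fun i => o ∘ₗ LinearMap.proj i ∘ₗ s.hom.hom, fun y => ?_⟩⟩
  have hs : p.hom.hom (s.hom.hom y) = y :=
    congrArg (fun k : P ⟶ P => k.hom.hom y) (Projective.factorThru_comp (𝟙 P) p)
  refine Eq.trans ?_ hs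
  have h1 := (LinearMap.pi_apply_eq_sum_univ p.hom.hom (s.hom.hom y)).symm
  refine Eq.trans (Finset.sum_congr rfl fun i _ => ?_) h1
  change _ • _ = _ • _
  congr 2
  ext j
  simp [Pi.single_apply, eq_comm]

end Pairing

/-! ### Morphisms into `D Tr Z` as functionals on `Hom(P₁, L)`. -/

section TransposePairing

variable {Λ : Type u} [Ring Λ] [IsNoetherianRing Λ] [IsNoetherianRing Λᵐᵒᵖ]

attribute [local instance] ringDual_finite

/-- The projection of `Hom_Λ(P₁, Λ)` onto the transpose. -/
noncomputable def trProj (Z : FGModuleCat.{u} Λᵐᵒᵖ) :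
    ((Projective.over (syz Z) : FGModuleCat.{u} Λᵐᵒᵖ) →ₗ[Λᵐᵒᵖ] Λ) →ₗ[Λ]
      (trObj (ringDual Λ) Z : FGModuleCat.{u} Λ) :=
  (cokernel.π ((ringDual Λ).map (presMap Z).op)).hom.hom

lemma trProj_surjective (Z : FGModuleCat.{u} Λᵐᵒᵖ) : Function.Surjective (trProj Z) :=
  fg_surjective_of_epi (cokernel.π ((ringDual Λ).map (presMap Z).op))

lemma trProj_comp (Z : FGModuleCat.{u} Λᵐᵒᵖ)
    (c : (Projective.over Z : FGModuleCat.{u} Λᵐᵒᵖ) →ₗ[Λᵐᵒᵖ] Λ) :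
    trProj Z (c ∘ₗ (presMap Z).hom.hom) = 0 :=
  congrArg (fun k : (ringDual Λ).obj (op (Projective.over Z)) ⟶ trObj (ringDual Λ) Z => k.hom.hom c)
    (cokernel.condition ((ringDual Λ).map (presMap Z).op))

/-- The categorical cokernel is compared with the quotient by the actual image: the quotient map
factors through the cokernel, so its kernel contains that of `trProj`. -/
lemma trProj_eq_zero (Z : FGModuleCat.{u} Λᵐᵒᵖ)
    (c : (Projective.over (syz Z) : FGModuleCat.{u} Λᵐᵒᵖ) →ₗ[Λᵐᵒᵖ] Λ) (hc : trProj Z c = 0) :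
    ∃ c₀ : (Projective.over Z : FGModuleCat.{u} Λᵐᵒᵖ) →ₗ[Λᵐᵒᵖ] Λ,
      c₀ ∘ₗ (presMap Z).hom.hom = c := by
  let f := (ringDual Λ).map (presMap Z).op
  let T : Type u := (Projective.over (syz Z) : FGModuleCat.{u} Λᵐᵒᵖ) →ₗ[Λᵐᵒᵖ] Λ
  let U : Submodule Λ T := LinearMap.range f.hom.hom
  let k : (ringDual Λ).obj (op (Projective.over (syz Z))) ⟶ FGModuleCat.of Λ (T ⧸ U) :=
    FGModuleCat.ofHom U.mkQ
  have hk : f ≫ k = 0 := FGModuleCat.hom_ext (LinearMap.ext fun x =>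
    (Submodule.Quotient.mk_eq_zero U).2 ⟨x, rfl⟩)
  have h1 : k.hom.hom c = 0 := by
    rw [← cokernel.π_desc f k hk]
    refine Eq.trans (congrArg (cokernel.desc f k hk).hom.hom hc) (map_zero _)
  exact (Submodule.Quotient.mk_eq_zero U).1 h1

lemma trMap_trProj {Z Z' : FGModuleCat.{u} Λᵐᵒᵖ} (a : Z ⟶ Z')
    (c : (Projective.over (syz Z') : FGModuleCat.{u} Λᵐᵒᵖ) →ₗ[Λᵐᵒᵖ] Λ) :
    (trMap (ringDual Λ) a).hom.hom (trProj Z' c) = trProj Z (c ∘ₗ (lift₁ a).hom.hom) :=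
  congrArg (fun k : (ringDual Λ).obj (op (Projective.over (syz Z'))) ⟶ trObj (ringDual Λ) Z =>
    k.hom.hom c) (π_trMap (ringDual Λ) a)

/-- A chosen dual basis of a projective module. -/
noncomputable def dualBasis (P : FGModuleCat.{u} Λᵐᵒᵖ) [Projective P] : DualBasis Λ P :=
  (nonempty_dualBasis P).some

variable (R : Type u) [CommRing R] [IsArtinianRing R] [Algebra R Λ] [Module.Finite R Λ]
variable (I : Type u) [AddCommGroup I] [Module R I] [IsEnvelopeOfSimples R I]

attribute [local instance] fgModR fgTowerR fgFiniteR DualMod.finite finite_hom finite_hom_sub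

/-- The module `D Tr Z`. -/
noncomputable abbrev dualTr (Z : FGModuleCat.{u} Λᵐᵒᵖ) : FGModuleCat.{u} Λᵐᵒᵖ :=
  (moduleDual R Λ I).obj (op (trObj (ringDual Λ) Z))

variable {R I} {L : FGModuleCat.{u} Λᵐᵒᵖ}

/-- The pairing of `Hom(L, D Tr Z)` and `Hom(P₁, L)`, where `P₁ ⟶ P₀ ⟶ Z` is the chosen
presentation. -/
noncomputable def trPair (Z : FGModuleCat.{u} Λᵐᵒᵖ) (h : L ⟶ dualTr R I Z) :
    ((Projective.over (syz Z) : FGModuleCat.{u} Λᵐᵒᵖ) ⟶ L) →ₗ[R] I where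
  toFun g := (dualBasis (Projective.over (syz Z))).pair (trProj Z) h.hom.hom g.hom.hom
  map_add' g g' := map_add ((dualBasis (Projective.over (syz Z))).pair (trProj Z) h.hom.hom) _ _
  map_smul' r g := map_smul ((dualBasis (Projective.over (syz Z))).pair (trProj Z) h.hom.hom) r
    g.hom.hom

variable {Z : FGModuleCat.{u} Λᵐᵒᵖ}

lemma trPair_presMap_comp (h : L ⟶ dualTr R I Z) (u : Projective.over Z ⟶ L) :
    trPair Z h (presMap Z ≫ u) = 0 :=
  (dualBasis (Projective.over (syz Z))).pair_comp_eq_zero (dualBasis (Projective.over Z)) _ _ _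
    (trProj_comp Z) _

lemma trPair_comp {L' : FGModuleCat.{u} Λᵐᵒᵖ} (b : L ⟶ L') (h : L' ⟶ dualTr R I Z)
    (g : Projective.over (syz Z) ⟶ L) : trPair Z (b ≫ h) g = trPair Z h (g ≫ b) := rfl

lemma trPair_trMap {Z' : FGModuleCat.{u} Λᵐᵒᵖ} (a : Z ⟶ Z') (h : L ⟶ dualTr R I Z)
    (g : Projective.over (syz Z') ⟶ L) :
    trPair Z' (h ≫ (moduleDual R Λ I).map (trMap (ringDual Λ) a).op) g =
      trPair Z h (lift₁ a ≫ g) :=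
  (dualBasis (Projective.over (syz Z))).pair_lcomp (dualBasis (Projective.over (syz Z'))) _ _ _ _ _
    (trMap_trProj a) _

lemma trPair_add (h h' : L ⟶ dualTr R I Z) : trPair Z (h + h') = trPair Z h + trPair Z h' :=
  LinearMap.ext fun g =>
    (dualBasis (Projective.over (syz Z))).pair_add_left (trProj Z) h.hom.hom h'.hom.hom g.hom.hom

lemma trPair_smul (r : R) (h : L ⟶ dualTr R I Z) : trPair Z (r • h) = r • trPair Z h :=
  LinearMap.ext fun g => (dualBasis (Projective.over (syz Z))).pair_smul_left (trProj Z) r h.hom.hom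
    (r • h).hom.hom (fun _ _ => rfl) g.hom.hom

lemma eq_zero_of_trPair_eq_zero (h : L ⟶ dualTr R I Z) (h0 : trPair Z h = 0) : h = 0 :=
  FGModuleCat.hom_ext ((dualBasis (Projective.over (syz Z))).eq_zero_of_pair (trProj Z)
    (trProj_surjective Z) h.hom.hom fun g => LinearMap.congr_fun h0 (FGModuleCat.ofHom g))

lemma exists_trPair_eq (θ : (Projective.over (syz Z) ⟶ L) →ₗ[R] I)
    (hθ : ∀ u : Projective.over Z ⟶ L, θ (presMap Z ≫ u) = 0) :
    ∃ h : L ⟶ dualTr R I Z, trPair Z h = θ := by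
  let P : FGModuleCat.{u} Λᵐᵒᵖ := Projective.over (syz Z)
  let θ' : (P →ₗ[Λᵐᵒᵖ] L) →ₗ[R] I :=
    { toFun := fun g => θ (FGModuleCat.ofHom g)
      map_add' := fun g g' => map_add θ (FGModuleCat.ofHom g) (FGModuleCat.ofHom g')
      map_smul' := fun r g => map_smul θ r (FGModuleCat.ofHom g) }
  obtain ⟨h, hh⟩ := (dualBasis P).exists_pair_eq (trProj Z)
    (trProj_surjective Z) (presMap Z).hom.hom (trProj_eq_zero Z) θ'
    (fun u => hθ (FGModuleCat.ofHom u))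
  exact ⟨FGModuleCat.ofHom h, LinearMap.ext fun g => hh g.hom.hom⟩

end TransposePairing

/-! ### The pairing of `Hom(K₀, D Tr Ωᵉ X)` with `Hom(X, Kₘ)`. -/

section ResolutionPairing

variable {Λ : Type u} [Ring Λ] [IsNoetherianRing Λ] [IsNoetherianRing Λᵐᵒᵖ]
variable (R : Type u) [CommRing R] [IsArtinianRing R] [Algebra R Λ] [Module.Finite R Λ]
variable (I : Type u) [AddCommGroup I] [Module R I] [IsEnvelopeOfSimples R I]

attribute [local instance] ringDual_finite fgModR fgTowerR fgFiniteR DualMod.finite finite_hom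
  finite_hom_sub

variable {e : ℕ} {K : ComposableArrows (FGModuleCat.{u} Λᵐᵒᵖ) (e + 1 + 1)}
  {X : PStab (FGModuleCat.{u} Λᵐᵒᵖ)}

variable {R I}

lemma ResRel.trPair_eq_zero (hK : IsExactSeq K)
    (h : K.obj' 0 ⟶ dualTr R I ((syzIter (FGModuleCat.{u} Λᵐᵒᵖ) e).obj X).as)
    {f : X.as ⟶ K.obj' (e + 1 + 1)} {g} (hfg : ResRel K f g)
    (hf : ∃ w : X.as ⟶ K.obj' (e + 1), w ≫ K.map' (e + 1) (e + 1 + 1) = f) :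
    trPair _ h g = 0 := by
  obtain ⟨a, rfl⟩ := hfg.eq_presMap_comp hK hf
  exact trPair_presMap_comp h a

/-- Two last components over the same `f` differ by a map through `P₁ ⟶ P₀`, which `trPair` kills;
so `f ↦ trPair h g` is well defined on the relation. -/
lemma exists_resPair (hK : IsExactSeq K)
    (h : K.obj' 0 ⟶ dualTr R I ((syzIter (FGModuleCat.{u} Λᵐᵒᵖ) e).obj X).as) :
    ∃ ψ : (X.as ⟶ K.obj' (e + 1 + 1)) →ₗ[R] I, ∀ f g, ResRel K f g → ψ f = trPair _ h g := by
  have := env_injective R I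
  obtain ⟨ψ, hψ⟩ := exists_comp_eq_of_ker_le
    (LinearMap.fst R _ _ ∘ₗ (resSubmodule K X R).subtype)
    (trPair _ h ∘ₗ LinearMap.snd R _ _ ∘ₗ (resSubmodule K X R).subtype) (by
      rintro ⟨⟨f, g⟩, hfg⟩ hf
      obtain rfl : f = 0 := hf
      exact ResRel.trPair_eq_zero hK h hfg ⟨0, zero_comp⟩)
  exact ⟨ψ, fun f g hfg => LinearMap.congr_fun hψ ⟨(f, g), hfg⟩⟩

/-- The functional on `Hom(X, Kₘ)` given by a morphism `K₀ ⟶ D Tr Ωᵉ X`. -/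
noncomputable def resPair (hK : IsExactSeq K)
    (h : K.obj' 0 ⟶ dualTr R I ((syzIter (FGModuleCat.{u} Λᵐᵒᵖ) e).obj X).as) :
    (X.as ⟶ K.obj' (e + 1 + 1)) →ₗ[R] I := (exists_resPair hK h).choose

lemma ResRel.resPair_eq (hK : IsExactSeq K)
    (h : K.obj' 0 ⟶ dualTr R I ((syzIter (FGModuleCat.{u} Λᵐᵒᵖ) e).obj X).as)
    {f : X.as ⟶ K.obj' (e + 1 + 1)} {g} (hfg : ResRel K f g) : resPair hK h f = trPair _ h g :=
  (exists_resPair hK h).choose_spec f g hfg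

lemma resPair_eq_zero (hK : IsExactSeq K)
    (h : K.obj' 0 ⟶ dualTr R I ((syzIter (FGModuleCat.{u} Λᵐᵒᵖ) e).obj X).as)
    (f : X.as ⟶ K.obj' (e + 1 + 1))
    (hf : ∃ w : X.as ⟶ K.obj' (e + 1), w ≫ K.map' (e + 1) (e + 1 + 1) = f) :
    resPair hK h f = 0 := by
  obtain ⟨g, hg⟩ := ResRel.exists hK f
  rw [hg.resPair_eq, hg.trPair_eq_zero hK h hf]

/-- Composing `g` with `K₀ ⟶ K₁` gives a map that factors through `P₁ ⟶ P₀`, by the definition of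
`ResRel`. -/
lemma resPair_comp_eq_zero (hK : IsExactSeq K)
    (h : K.obj' 1 ⟶ dualTr R I ((syzIter (FGModuleCat.{u} Λᵐᵒᵖ) e).obj X).as) :
    resPair (X := X) hK (K.map' 0 1 ≫ h) = 0 :=
  LinearMap.ext fun f => by
    obtain ⟨g, hg⟩ := ResRel.exists hK f
    rw [hg.resPair_eq, trPair_comp]
    obtain ⟨f', -, F, -, hF⟩ := hg
    rw [hF, trPair_presMap_comp]
    rfl

/-- The hypothesis makes `trPair Z h` vanish on the kernel of `Hom(P₁, K₀) ⟶ Hom(P₁, K₁)/Hom(P₀,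
K₁)`. Hence it extends to a functional on the target, and this functional comes from some `h'` on
`K₁`. -/
lemma exists_comp_eq_of_resPair (hK : IsExactSeq K) (hE : SyzIterExtends K X e)
    (h : K.obj' 0 ⟶ dualTr R I ((syzIter (FGModuleCat.{u} Λᵐᵒᵖ) e).obj X).as)
    (h0 : resPair (X := X) hK h = 0) :
    ∃ h' : K.obj' 1 ⟶ dualTr R I ((syzIter (FGModuleCat.{u} Λᵐᵒᵖ) e).obj X).as,
      K.map' 0 1 ≫ h' = h := by
  have := env_injective R I
  let Z : FGModuleCat.{u} Λᵐᵒᵖ := ((syzIter (FGModuleCat.{u} Λᵐᵒᵖ) e).obj X).as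
  let U := LinearMap.range (Linear.leftComp R (K.obj' 1) (presMap Z))
  obtain ⟨θ, hθ⟩ := exists_comp_eq_of_ker_le
    (U.mkQ ∘ₗ Linear.rightComp R (Projective.over (syz Z)) (K.map' 0 1)) (trPair Z h) (by
      intro g hg
      obtain ⟨F, hF⟩ := (Submodule.Quotient.mk_eq_zero U).1 hg
      obtain ⟨f, hf⟩ := ResRel.exists_of_comp hK hE g ⟨F, hF.symm⟩
      exact (hf.resPair_eq hK h).symm.trans (LinearMap.congr_fun h0 f))
  obtain ⟨h', hh'⟩ := exists_trPair_eq (Z := Z) (θ ∘ₗ U.mkQ) (fun u => by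
    refine Eq.trans (congrArg θ ?_) (map_zero θ)
    exact (Submodule.Quotient.mk_eq_zero U).2 ⟨u, rfl⟩)
  refine ⟨h', sub_eq_zero.1 (eq_zero_of_trPair_eq_zero _ ?_)⟩
  have h1 : trPair Z (K.map' 0 1 ≫ h') = trPair Z h := LinearMap.ext fun g => by
    rw [trPair_comp, hh']
    exact LinearMap.congr_fun hθ g
  have h2 := trPair_add (Z := Z) (K.map' 0 1 ≫ h' - h) h
  rw [sub_add_cancel, h1] at h2
  exact right_eq_add.1 h2

/-- Here `ψ` is carried from the `f` side of the relation to the `g` side. The resulting `θ` kills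
maps through `P₁ ⟶ P₀`, since these correspond to boundaries. -/
lemma exists_resPair_eq (hK : IsExactSeq K) (hE : SyzIterExtends K X e)
    (ψ : (X.as ⟶ K.obj' (e + 1 + 1)) →ₗ[R] I)
    (hψ : ∀ w : X.as ⟶ K.obj' (e + 1), ψ (w ≫ K.map' (e + 1) (e + 1 + 1)) = 0) :
    ∃ h : K.obj' 0 ⟶ dualTr R I ((syzIter (FGModuleCat.{u} Λᵐᵒᵖ) e).obj X).as,
      resPair (X := X) hK h = ψ := by
  have := env_injective R I
  obtain ⟨θ, hθ⟩ := exists_comp_eq_of_ker_le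
    (LinearMap.snd R _ _ ∘ₗ (resSubmodule K X R).subtype)
    (ψ ∘ₗ LinearMap.fst R _ _ ∘ₗ (resSubmodule K X R).subtype) (by
      rintro ⟨⟨f, g⟩, hfg⟩ hg
      obtain rfl : g = 0 := hg
      -- With `g = 0 = presMap ≫ 0`, the morphism `f` is a boundary, on which `ψ` vanishes.
      obtain ⟨w, rfl⟩ := ResRel.isBoundary_left hK hE (a := 0) (by rw [comp_zero]; exact hfg)
      exact hψ w)
  have hθ' (f g) (hfg : ResRel K f g) : θ g = ψ f := LinearMap.congr_fun hθ ⟨(f, g), hfg⟩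
  obtain ⟨h, hh⟩ := exists_trPair_eq θ (fun u => by
    obtain ⟨f, hf⟩ := ResRel.presMap_comp u hK hE
    obtain ⟨w, rfl⟩ := ResRel.isBoundary_left hK hE hf
    rw [hθ' _ _ hf, hψ])
  refine ⟨h, LinearMap.ext fun f => ?_⟩
  obtain ⟨g, hg⟩ := ResRel.exists hK f
  rw [hg.resPair_eq, hh, hθ' _ _ hg]

lemma resPair_add (hK : IsExactSeq K)
    (h h' : K.obj' 0 (Nat.zero_le _) ⟶ dualTr R I ((syzIter (FGModuleCat.{u} Λᵐᵒᵖ) e).obj X).as) :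
    resPair (X := X) hK (h + h') = resPair hK h + resPair hK h' :=
  LinearMap.ext fun f => by
    obtain ⟨g, hg⟩ := ResRel.exists hK f
    rw [LinearMap.add_apply, hg.resPair_eq, hg.resPair_eq, hg.resPair_eq, trPair_add]
    rfl

lemma resPair_smul (hK : IsExactSeq K) (r : R)
    (h : K.obj' 0 ⟶ dualTr R I ((syzIter (FGModuleCat.{u} Λᵐᵒᵖ) e).obj X).as) :
    resPair (X := X) hK (r • h) = r • resPair hK h :=
  LinearMap.ext fun f => by
    obtain ⟨g, hg⟩ := ResRel.exists hK f
    rw [LinearMap.smul_apply, hg.resPair_eq, hg.resPair_eq, trPair_smul]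
    rfl

/-- If `g` lies over `f`, then `lift₁ b ≫ g ≫ φ₀` lies over `a ≫ f ≫ φₘ`, and on the other side
`trPair` turns precomposition with `lift₁ b` into `D Tr b`. -/
lemma resPair_naturality {K' : ComposableArrows (FGModuleCat.{u} Λᵐᵒᵖ) (e + 1 + 1)}
    (hK : IsExactSeq K) (hK' : IsExactSeq K') {X' : PStab (FGModuleCat.{u} Λᵐᵒᵖ)}
    (a : X'.as ⟶ X.as) (φ : K ⟶ K') :
    ∃ b : ((syzIter (FGModuleCat.{u} Λᵐᵒᵖ) e).obj X').as ⟶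
        ((syzIter (FGModuleCat.{u} Λᵐᵒᵖ) e).obj X).as,
      (syzIter _ e).map ((Quotient.functor (projRel (FGModuleCat.{u} Λᵐᵒᵖ))).map a : X' ⟶ X) =
        (Quotient.functor (projRel _)).map b ∧
      ∀ (h : K'.obj' 0 ⟶ dualTr R I ((syzIter (FGModuleCat.{u} Λᵐᵒᵖ) e).obj X').as)
        (f : X.as ⟶ K.obj' (e + 1 + 1)),
        resPair (X := X) hK ((ComposableArrows.app' φ 0 ≫ h) ≫
          (moduleDual R Λ I).map (trMap (ringDual Λ) b).op) f =
        resPair hK' h ((a ≫ f) ≫ ComposableArrows.app' φ (e + 1 + 1)) := by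
  obtain ⟨b, hb, H⟩ := ResRel.exists_comp (X := X) a φ
  refine ⟨b, hb, fun h f => ?_⟩
  obtain ⟨g, hg⟩ := ResRel.exists hK f
  rw [Category.assoc, Category.assoc, hg.resPair_eq, (H f g hg).resPair_eq hK', trPair_comp,
    trPair_trMap]

end ResolutionPairing

/-- A natural isomorphism between uncurried bifunctors on a quotient category. -/
lemma nonempty_uncurry_flip_iso {A B D : Type v} [Category.{w} A] [Category.{w} B] [Category.{w} D]
    {r : HomRel B} (G G' : CategoryTheory.Quotient r ⥤ A ⥤ D)
    (F : ∀ (a : A) (b : B), (G.obj ((Quotient.functor r).obj b)).obj a ≅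
      (G'.obj ((Quotient.functor r).obj b)).obj a)
    (hF : ∀ {a a' : A} (φ : a ⟶ a') {b b' : B} (f : b ⟶ b'),
      ((G.obj ((Quotient.functor r).obj b)).map φ ≫
        (G.map ((Quotient.functor r).map f)).app a') ≫ (F a' b').hom =
      (F a b).hom ≫ (G'.obj ((Quotient.functor r).obj b)).map φ ≫
        (G'.map ((Quotient.functor r).map f)).app a') :
    Nonempty (Functor.uncurry.obj G.flip ≅ Functor.uncurry.obj G'.flip) := by
  refine ⟨NatIso.ofComponents (fun p => F p.1 p.2.as) ?_⟩
  rintro ⟨a, ⟨b⟩⟩ ⟨a', ⟨b'⟩⟩ ⟨φ, f⟩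
  obtain ⟨f, rfl⟩ := (Quotient.functor r).map_surjective f
  exact hF φ f

lemma fgCoker_lin_ext {R : Type u} [CommRing R] {I : Type u} [AddCommGroup I] [Module R I]
    {A B : Type u} [AddCommGroup A] [Module R A] [AddCommGroup B] [Module R B]
    [Module.Finite R B] {f : A →ₗ[R] B} {g h : fgCoker f →ₗ[R] I}
    (H : ∀ x, g (fgCokerMk f x) = h (fgCokerMk f x)) : g = h :=
  LinearMap.ext fun x => by
    obtain ⟨x, rfl⟩ := fgCokerMk_surjective f x
    exact H x

/-! ### The comparison isomorphism and its naturality. -/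

section DefectFormula

variable {R : Type u} [CommRing R] [IsArtinianRing R]
variable {Λ : Type u} [Ring Λ] [Algebra R Λ] [Module.Finite R Λ]
  [IsNoetherianRing Λ] [IsNoetherianRing Λᵐᵒᵖ]
variable (I : Type u) [AddCommGroup I] [Module R I] [IsEnvelopeOfSimples R I]

attribute [local instance] ringDual_finite fgModR fgTowerR fgFiniteR DualMod.finite finite_hom
  finite_hom_sub

variable {e : ℕ} {M : ObjectProperty (FGModuleCat.{u} Λᵐᵒᵖ)} (hM : IsClusterTilting (e + 1) M)
variable (δ : DEx (e + 1) M.FullSubcategory) (X : M.FullSubcategory)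

lemma DEx.isExactSeq (R : Type u) [CommRing R] [IsArtinianRing R] [Algebra R Λ] [Module.Finite R Λ]
    (I : Type u) [AddCommGroup I] [Module R I] [IsEnvelopeOfSimples R I]
    (hM : IsClusterTilting (e + 1) M) (δ : DEx (e + 1) M.FullSubcategory) :
    IsExactSeq (DEx.seq.obj δ) :=
  DEx.seq_isExactSeq hM δ (DEx.mono hM δ) (DEx.epi R I hM δ)

/-- An object of `M` as an object of the stable category. -/
abbrev stableObj (X : M.FullSubcategory) : PStab (FGModuleCat.{u} Λᵐᵒᵖ) :=
  (Quotient.functor _).obj X.obj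

/-- A representative of `τ_(e+1) X`. -/
noncomputable abbrev tauObj (R : Type u) [CommRing R] [IsArtinianRing R] [Algebra R Λ]
    [Module.Finite R Λ] (I : Type u) [AddCommGroup I] [Module R I] [IsEnvelopeOfSimples R I] (e : ℕ)
    (X : M.FullSubcategory) : FGModuleCat.{u} Λᵐᵒᵖ :=
  dualTr R I ((syzIter (FGModuleCat.{u} Λᵐᵒᵖ) e).obj (stableObj X)).as

/-- The functional on the contravariant defect given by a morphism `L ⟶ τ_(e+1) X`. -/
noncomputable def defectPair :
    ((δ.obj.obj' 0).obj ⟶ tauObj R I e X) →ₗ[R] (contraDefectObj R δ X →ₗ[R] I) where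
  toFun h := (LinearMap.range (Linear.rightComp R X (δ.obj.map' (e + 1) (e + 1 + 1)))).liftQ
    (resPair (X := stableObj X) (DEx.isExactSeq R I hM δ) h ∘ₗ M.ι.mapLinearMap R) (by
      rintro _ ⟨w, rfl⟩
      exact resPair_eq_zero (X := stableObj X) (DEx.isExactSeq R I hM δ) h _ ⟨w.hom, rfl⟩)
  map_add' h h' := fgCoker_lin_ext fun f =>
    LinearMap.congr_fun (resPair_add (X := stableObj X) (DEx.isExactSeq R I hM δ) h h') f.hom
  map_smul' r h := fgCoker_lin_ext fun f =>
    LinearMap.congr_fun (resPair_smul (X := stableObj X) (DEx.isExactSeq R I hM δ) r h) f.hom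

lemma range_le_ker_defectPair :
    LinearMap.range (Linear.leftComp R (tauObj R I e X) (δ.obj.map' 0 1).hom) ≤
      LinearMap.ker (defectPair I hM δ X) := by
  rintro _ ⟨h, rfl⟩
  exact fgCoker_lin_ext fun f => LinearMap.congr_fun
    (resPair_comp_eq_zero (X := stableObj X) (DEx.isExactSeq R I hM δ) h) f.hom

/-- This inclusion makes the comparison map injective; it is the one that uses the vanishing of
`Ext`. -/
lemma ker_defectPair_le :
    LinearMap.ker (defectPair I hM δ X) ≤
      LinearMap.range (Linear.leftComp R (tauObj R I e X) (δ.obj.map' 0 1).hom) := by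
  intro h hh
  refine exists_comp_eq_of_resPair (X := stableObj X) (DEx.isExactSeq R I hM δ)
    (DEx.syzIterExtends hM δ _ X.property) h (LinearMap.ext fun f => ?_)
  exact LinearMap.congr_fun (show defectPair I hM δ X h = 0 from hh)
    (fgCokerMk (Linear.rightComp R X (δ.obj.map' (e + 1) (e + 1 + 1))) (ObjectProperty.homMk f))

lemma defectPair_surjective : Function.Surjective (defectPair (R := R) I hM δ X) := by
  intro ψ
  let Ψ : (X.obj ⟶ (δ.obj.obj' (e + 1 + 1)).obj) →ₗ[R] I :=
    { toFun := fun f => ψ (fgCokerMk (Linear.rightComp R X (δ.obj.map' (e + 1) (e + 1 + 1)))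
        (ObjectProperty.homMk f))
      map_add' := fun f g => map_add (ψ ∘ₗ fgCokerMk (Linear.rightComp R X
        (δ.obj.map' (e + 1) (e + 1 + 1)))) (ObjectProperty.homMk f) (ObjectProperty.homMk g)
      map_smul' := fun r f => map_smul (ψ ∘ₗ fgCokerMk (Linear.rightComp R X
        (δ.obj.map' (e + 1) (e + 1 + 1)))) r (ObjectProperty.homMk f) }
  obtain ⟨h, hh⟩ := exists_resPair_eq (X := stableObj X) (DEx.isExactSeq R I hM δ)
    (DEx.syzIterExtends hM δ _ X.property) Ψ (fun w => by
      refine Eq.trans (congrArg ψ ?_) (map_zero ψ)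
      exact (Submodule.Quotient.mk_eq_zero _).2 ⟨ObjectProperty.homMk w, rfl⟩)
  exact ⟨h, fgCoker_lin_ext fun f => LinearMap.congr_fun hh f.hom⟩

/-- The comparison map `δ_*(τ_(e+1) X) ⟶ D δ^*(X)`. -/
noncomputable def defectHom :
    covDefectObj R δ (tauObj R I e X) ⟶ (dualR R I).obj (op (contraDefectObj R δ X)) :=
  ⟨ModuleCat.ofHom ((LinearMap.range (Linear.leftComp R (tauObj R I e X)
    (δ.obj.map' 0 1).hom)).liftQ (defectPair I hM δ X) (range_le_ker_defectPair I hM δ X))⟩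

lemma isIso_defectHom : IsIso (defectHom (R := R) I hM δ X) := by
  have h1 : Mono (defectHom (R := R) I hM δ X) := fg_mono_of_injective _ (LinearMap.ker_eq_bot.1
    (Submodule.ker_liftQ_eq_bot _ _ _ (ker_defectPair_le I hM δ X)))
  have h2 : Epi (defectHom (R := R) I hM δ X) := fg_epi_of_surjective _ fun ψ => by
    obtain ⟨h, rfl⟩ := defectPair_surjective I hM δ X ψ
    exact ⟨fgCokerMk (Linear.leftComp R (tauObj R I e X) (δ.obj.map' 0 1).hom) h, rfl⟩
  exact isIso_of_mono_of_epi _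

/-- The comparison map as an isomorphism. -/
noncomputable def defectIso :
    covDefectObj R δ (tauObj R I e X) ≅ (dualR R I).obj (op (contraDefectObj R δ X)) :=
  have := isIso_defectHom (R := R) I hM δ X
  asIso (defectHom I hM δ X)

/-- The value of `τ_d` on a morphism can be computed from any representative `b` of the syzygy
morphism, in particular from the one that `resPair_naturality` supplies. -/
lemma tau_map_eq {X X' : M.FullSubcategory} (a : X ⟶ X')
    (b : ((syzIter (FGModuleCat.{u} Λᵐᵒᵖ) e).obj (stableObj X)).as ⟶
      ((syzIter (FGModuleCat.{u} Λᵐᵒᵖ) e).obj (stableObj X')).as)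
    (hb : (syzIter (FGModuleCat.{u} Λᵐᵒᵖ) e).map ((Quotient.functor (projRel _)).map a.hom) =
        (Quotient.functor (projRel _)).map b) :
    (tau R Λ I (e + 1)).map ((SubStab.incl M).map ((Quotient.functor (subProjRel M)).map a)) =
      (Quotient.functor (injRel (FGModuleCat.{u} Λᵐᵒᵖ))).map
        ((moduleDual R Λ I).map (trMap (ringDual Λ) b).op) := by
  change (dualStable R Λ I).map ((trFunctor (ringDual Λ) (projective_ringDual Λ)).map
    ((syzIter _ e).map ((Quotient.functor (projRel (FGModuleCat.{u} Λᵐᵒᵖ))).map a.hom))) = _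
  rw [hb]
  rfl

lemma defectHom_naturality {δ δ' : DEx (e + 1) M.FullSubcategory} (φ : δ' ⟶ δ)
    {X X' : M.FullSubcategory} (a : X ⟶ X') :
    (((covDefect R (e + 1) M).obj (tauObj R I e X)).map φ.op ≫
      ((covDefectStable R hM).map ((tau R Λ I (e + 1)).map ((SubStab.incl M).map
        ((Quotient.functor (subProjRel M)).map a)))).app (op δ')) ≫ defectHom I hM δ' X' =
    defectHom I hM δ X ≫ (dualR R I).map (((contraDefect R (e + 1) M).obj (op X)).map φ).op ≫
      (dualR R I).map (((contraDefect R (e + 1) M).map a.op).app δ').op := by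
  obtain ⟨b, hb, H⟩ := resPair_naturality (R := R) (I := I) (X := stableObj X') (X' := stableObj X)
    (DEx.isExactSeq R I hM δ') (DEx.isExactSeq R I hM δ) a.hom (DEx.seq.map φ)
  rw [tau_map_eq I a b hb]
  refine fgCoker_hom_ext fun h => fgCoker_lin_ext fun f => ?_
  -- On classes of `h` and `f`, both sides of the square unfold to the two sides of
  -- `resPair_naturality`.
  exact H h f.hom

set_option maxHeartbeats 1000000 in
/-- The higher Auslander defect formula. -/
theorem nonempty_covDefectTau_iso :
    Nonempty (covDefectTau R I hM ≅ dualContraDefect R I hM) := by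
  let F (δ : (DEx (e + 1) M.FullSubcategory)ᵒᵖ) (X : M.FullSubcategory) :
      ((SubStab.incl M ⋙ tau R Λ I (e + 1) ⋙ covDefectStable R hM).obj
        ((Quotient.functor (subProjRel M)).obj X)).obj δ ≅
      ((contraDefectStable R I hM ⋙ Functor.opHom _ _ ⋙
        (Functor.whiskeringRight _ _ _).obj (dualR R I)).obj
        ((Quotient.functor (subProjRel M)).obj X)).obj δ := defectIso I hM δ.unop X
  unfold covDefectTau dualContraDefect
  refine nonempty_uncurry_flip_iso (r := subProjRel M) _ _ F fun {δ δ'} φ {X X'} a => ?_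
  exact defectHom_naturality (R := R) I hM φ.unop a

end DefectFormula

end HigherAR

theorem mainTheorem2 {R : Type u} [CommRing R] [IsArtinianRing R]
    {Λ : Type u} [Ring Λ] [Algebra R Λ] [Module.Finite R Λ]
    (I : Type u) [AddCommGroup I] [Module R I] [HigherAR.IsEnvelopeOfSimples R I]
    (d : ℕ) (hd : 1 ≤ d)
    (M : CategoryTheory.ObjectProperty (FGModuleCat.{u} Λᵐᵒᵖ))
    (hM : HigherAR.IsClusterTilting d M) :
    Nonempty (HigherAR.dualContraDefect R I hM ≅ HigherAR.covDefectTau R I hM) := by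
  have : IsNoetherianRing Λ := IsNoetherianRing.of_finite R Λ
  have : IsNoetherianRing Λᵐᵒᵖ := IsNoetherianRing.of_finite R Λᵐᵒᵖ
  obtain ⟨e, rfl⟩ : ∃ e, d = e + 1 := ⟨d - 1, by omega⟩
  exact (HigherAR.nonempty_covDefectTau_iso I hM).map Iso.symm
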